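/- Let $(X_{i,j})_{i,j\ge 1}$ be an array of i.i.d. exponential random variables of some rate $r>0$. A directed lattice path from $(a,b)$ to $(c,d)$, where $a,b,c,d\ge 1$, is a sequence of lattice points $(i_0,j_0)=(a,b),\dots,(i_m,j_m)=(c,d)$ of minimal length $m=|c-a|+|d-b|$ such that $|i_{k+1}-i_k|+|j_{k+1}-j_k|=1$ for $0\le k<m$. The last passage percolation time from $(a,b)$ to $(c,d)$ is $$L(a,b;c,d)=\max_{\pi}\sum_{(i,j)\in\pi}X_{i,j},$$ the maximum being over all directed lattice paths $\pi$ from $(a,b)$ to $(c,d)$. Then, for every $n\ge 2$, the random vectors in $\mathbb{R}^{n-1}$ $$V_n=\big(L(1,1;n-k,k)\big)_{k=1}^{n-1}\qquad\text{and}\qquad W_n=\big(L(n-k,1;1,k)\big)_{k=1}^{n-1}$$ are equal in distribution (as vectors, i.e. jointly in all coordinates). -/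

import Mathlib

open MeasureTheory ProbabilityTheory

namespace LPP

/-- The `ℓ¹` distance `|c - a| + |d - b|` between the lattice points `(a, b)` and `(c, d)`. -/
def gridDist (u v : ℕ × ℕ) : ℕ :=
  ((v.1 : ℤ) - (u.1 : ℤ)).natAbs + ((v.2 : ℤ) - (u.2 : ℤ)).natAbs

/-- `π` is a directed lattice path from `u` to `v`: a sequence of lattice points
`π 0 = u, π 1, …, π m = v` of minimal length `m = gridDist u v`, with steps of `ℓ¹` length one. -/
def IsDirectedPath (u v : ℕ × ℕ) (π : Fin (gridDist u v + 1) → ℕ × ℕ) : Prop :=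
  π 0 = u ∧ π (Fin.last _) = v ∧
    ∀ k : Fin (gridDist u v), gridDist (π k.castSucc) (π k.succ) = 1

/-- The last passage percolation time from `u` to `v` with weights `x`: the largest total weight
of a directed lattice path from `u` to `v`. The supremum is over a finite nonempty set of values,
hence a maximum (`isGreatest_lppTime`); a directed path never visits a vertex twice, so the sum
over its steps is the sum over its vertices. -/
noncomputable def lppTime (x : ℕ × ℕ → ℝ) (u v : ℕ × ℕ) : ℝ :=
  ⨆ π : {π : Fin (gridDist u v + 1) → ℕ × ℕ // IsDirectedPath u v π}, ∑ k, x (π.1 k)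

/-- `V_n = (L(1,1; n-1,1), L(1,1; n-2,2), …, L(1,1; 1,n-1))`;
the `k`-th coordinate, `1 ≤ k ≤ n - 1`, sits at index `k - 1`. -/
noncomputable def vecV (n : ℕ) (x : ℕ × ℕ → ℝ) : Fin (n - 1) → ℝ :=
  fun k => lppTime x (1, 1) (n - (k.val + 1), k.val + 1)

/-- `W_n = (L(n-1,1; 1,1), L(n-2,1; 1,2), …, L(1,1; 1,n-1))`;
the `k`-th coordinate, `1 ≤ k ≤ n - 1`, sits at index `k - 1`. -/
noncomputable def vecW (n : ℕ) (x : ℕ × ℕ → ℝ) : Fin (n - 1) → ℝ :=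
  fun k => lppTime x (n - (k.val + 1), 1) (1, k.val + 1)

theorem exists_steps (m : ℕ) : ∀ u v : ℕ × ℕ, gridDist u v = m →
    ∃ π : Fin (m + 1) → ℕ × ℕ, π 0 = u ∧ π (Fin.last _) = v ∧
      ∀ k : Fin m, gridDist (π k.castSucc) (π k.succ) = 1 := by
  induction m with
  | zero =>
    intro u v h
    refine ⟨fun _ => u, rfl, ?_, fun k => k.elim0⟩
    simp only [gridDist] at h
    exact Prod.ext (by dsimp only; omega) (by dsimp only; omega)
  | succ m ih =>
    intro u v h
    have key : ∃ w, gridDist u w = 1 ∧ gridDist w v = m := by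
      simp only [gridDist] at h ⊢
      rcases lt_trichotomy u.1 v.1 with h1 | h1 | h1
      · exact ⟨(u.1 + 1, u.2), by dsimp only; omega, by dsimp only; omega⟩
      · rcases le_total u.2 v.2 with h2 | h2
        · exact ⟨(u.1, u.2 + 1), by dsimp only; omega, by dsimp only; omega⟩
        · exact ⟨(u.1, u.2 - 1), by dsimp only; omega, by dsimp only; omega⟩
      · exact ⟨(u.1 - 1, u.2), by dsimp only; omega, by dsimp only; omega⟩
    obtain ⟨w, hw, hwv⟩ := key
    obtain ⟨π, h0, hl, hs⟩ := ih w v hwv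
    refine ⟨Fin.cons u π, rfl, ?_, ?_⟩
    · rw [← Fin.succ_last, Fin.cons_succ, hl]
    · intro k
      refine Fin.cases ?_ (fun j => ?_) k
      · simpa [h0] using hw
      · simpa [← Fin.succ_castSucc] using hs j

instance nonempty_paths (u v : ℕ × ℕ) :
    Nonempty {π : Fin (gridDist u v + 1) → ℕ × ℕ // IsDirectedPath u v π} := by
  obtain ⟨π, hπ⟩ := exists_steps _ u v rfl
  exact ⟨⟨π, hπ⟩⟩

instance finite_paths (u v : ℕ × ℕ) :
    Finite {π : Fin (gridDist u v + 1) → ℕ × ℕ // IsDirectedPath u v π} := by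
  have hfin : (Set.pi Set.univ fun _ : Fin (gridDist u v + 1) =>
      Set.Iic ((u.1 + gridDist u v, u.2 + gridDist u v) : ℕ × ℕ)).Finite :=
    Set.Finite.pi fun _ => Set.finite_Iic _
  have hsub : {π | IsDirectedPath u v π} ⊆ (Set.pi Set.univ fun _ : Fin (gridDist u v + 1) =>
      Set.Iic ((u.1 + gridDist u v, u.2 + gridDist u v) : ℕ × ℕ)) := by
    rintro π ⟨h0, -, hs⟩ k -
    have main : ∀ i : Fin (gridDist u v + 1),
        (π i).1 ≤ u.1 + i.val ∧ (π i).2 ≤ u.2 + i.val := by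
      intro i
      induction i using Fin.induction with
      | zero => rw [h0]; exact ⟨Nat.le_add_right _ _, Nat.le_add_right _ _⟩
      | succ i ih =>
        have h2 : (((π i.succ).1 : ℤ) - ((π i.castSucc).1 : ℤ)).natAbs +
            (((π i.succ).2 : ℤ) - ((π i.castSucc).2 : ℤ)).natAbs = 1 := hs i
        simp only [Fin.val_castSucc, Fin.val_succ] at ih ⊢
        constructor <;> omega
    have hmain := main k
    have hk := k.2
    exact ⟨hmain.1.trans (by dsimp only; omega), hmain.2.trans (by dsimp only; omega)⟩
  exact (hfin.subset hsub).to_subtype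

/-- The last passage time is the maximum of the path weights. -/
theorem isGreatest_lppTime (x : ℕ × ℕ → ℝ) (u v : ℕ × ℕ) :
    IsGreatest {s : ℝ | ∃ π, IsDirectedPath u v π ∧ s = ∑ k, x (π k)} (lppTime x u v) := by
  constructor
  · obtain ⟨π, hπ⟩ := exists_eq_ciSup_of_finite
      (f := fun π : {π : Fin (gridDist u v + 1) → ℕ × ℕ // IsDirectedPath u v π} =>
        ∑ k, x (π.1 k))
    exact ⟨π.1, π.2, hπ.symm⟩
  · rintro s ⟨π, hπ, rfl⟩
    exact le_ciSup (f := fun π : {π : Fin (gridDist u v + 1) → ℕ × ℕ // IsDirectedPath u v π} =>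
      ∑ k, x (π.1 k)) (Set.finite_range _).bddAbove ⟨π, hπ⟩

end LPP

/-!
The two vectors are recorded while the same staircase array of independent exponential weights is
inserted, column by column, into a triangular (Gelfand–Tsetlin) pattern. A local rule updates the
entries of a level one at a time: a carry `e ≥ 0` arrives at an entry `κ` confined to an interval
`[a, b]`, and a new entry and a new carry leave. Only two properties of the rule matter for the
law: it preserves Lebesgue measure on `[a, b] × [0, ∞)`, and the new entry and the new carry add
up to `a + b - κ + e` (`LocalRule`). The Robinson–Schensted–Knuth rule and the Burge rule both have
them.

*Independence of the rule.* Exponential densities depend only on totals, so an exponential column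
inserted into a pattern that is uniform given its top level yields again a pattern that is uniform
given its top level, and the joint law of the old top level and the new pattern is the same for all
rules (`Pattern.lintegral_insert`). Inserting columns of decreasing height, and dropping the top
level after each insertion, shows by induction that the record, the sequence of the first entries
of the top levels, has a law that does not depend on the rule (`Pattern.lintegral_record`). The
pattern to start from is zero, which does not itself fall under this statement. It is the limit of
patterns chosen uniformly among those with top level in a small box, and the record depends
continuously on the pattern (`Pattern.le_of_lintegral_eq`, `Pattern.map_record_zero`).

*First entries.* Under the Robinson–Schensted–Knuth rule the first entry of a level satisfies the
recursion of the last passage times through the columns in their order of insertion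
(`growth_rskRule`). Under the Burge rule it is the last passage time through the columns in the
reverse order (`growth_burgeRule`). This rests on an exchange of two columns that leaves all
passage times through them unchanged (`passage_exchange`): the first entries of a pattern are the
passage times through its lines, that is, through the increments of its entries from level to
level, and the Burge rule makes the inserted column travel through these lines. Reversing the order
of the columns reflects the array, which turns the paths of `V_n` into those of `W_n`
(`vecV_eq_growth`, `vecW_eq_growth`).
-/

namespace LPP

open scoped ENNReal

/-! ### Local rules -/

/-- Prepend an entry to a real sequence. -/
def seqCons (x : ℝ) (s : ℕ → ℝ) : ℕ → ℝ
  | 0 => x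
  | n + 1 => s n

/-- Drop the first entry of a real sequence. -/
def seqTail (s : ℕ → ℝ) : ℕ → ℝ := fun n => s (n + 1)

@[simp] theorem seqCons_zero (x : ℝ) (s : ℕ → ℝ) : seqCons x s 0 = x := rfl

@[simp] theorem seqCons_succ (x : ℝ) (s : ℕ → ℝ) (n : ℕ) : seqCons x s (n + 1) = s n := rfl

@[simp] theorem seqTail_apply (s : ℕ → ℝ) (n : ℕ) : seqTail s n = s (n + 1) := rfl

@[simp] theorem seqTail_seqCons (x : ℝ) (s : ℕ → ℝ) : seqTail (seqCons x s) = s := rfl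

theorem continuous_seqCons : Continuous fun p : ℝ × (ℕ → ℝ) => seqCons p.1 p.2 := by
  refine continuous_pi fun n => ?_
  cases n with
  | zero => exact continuous_fst
  | succ n => exact (continuous_apply n).comp continuous_snd

@[fun_prop]
theorem _root_.Continuous.seqCons {α : Type*} [TopologicalSpace α] {f : α → ℝ} {g : α → ℕ → ℝ}
    (hf : Continuous f) (hg : Continuous g) : Continuous fun x => LPP.seqCons (f x) (g x) :=
  continuous_seqCons.comp (hf.prodMk hg)

@[fun_prop]
theorem _root_.Continuous.seqTail {α : Type*} [TopologicalSpace α] {g : α → ℕ → ℝ}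
    (hg : Continuous g) : Continuous fun x => LPP.seqTail (g x) :=
  continuous_pi fun n => (continuous_apply (n + 1)).comp hg

theorem measurable_seqCons : Measurable fun p : ℝ × (ℕ → ℝ) => seqCons p.1 p.2 :=
  continuous_seqCons.measurable

/-- A local rule for inserting a carry `e ≥ 0` at an old entry `κ` confined to `[a, b]`: it yields
a new entry `out a b κ e` of `[a, b]` and a new carry `e' = a + b - κ + e - out a b κ e`.
The defining property is that `(κ, e) ↦ (out, e')` preserves Lebesgue measure
on `[a, b] × [0, ∞)`. -/
structure LocalRule where
  /-- The new entry. -/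
  out : ℝ → ℝ → ℝ → ℝ → ℝ
  continuous_out : Continuous fun p : ℝ × ℝ × ℝ × ℝ => out p.1 p.2.1 p.2.2.1 p.2.2.2
  out_mem : ∀ {a b κ e : ℝ}, a ≤ κ → κ ≤ b → 0 ≤ e → a ≤ out a b κ e ∧ out a b κ e ≤ b
  carry_nonneg : ∀ {a b κ e : ℝ}, a ≤ κ → κ ≤ b → 0 ≤ e → 0 ≤ a + b - κ + e - out a b κ e
  lintegral_out : ∀ (a b : ℝ) (h : ℝ × ℝ → ℝ≥0∞), Measurable h →
    ∫⁻ κ in Set.Icc a b, ∫⁻ e in Set.Ici 0, h (out a b κ e, a + b - κ + e - out a b κ e) =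
      ∫⁻ o in Set.Icc a b, ∫⁻ e in Set.Ici 0, h (o, e)

@[fun_prop]
theorem LocalRule.continuous_out' (φ : LocalRule) {α : Type*} [TopologicalSpace α]
    {a b κ e : α → ℝ} (ha : Continuous a) (hb : Continuous b) (hκ : Continuous κ)
    (he : Continuous e) : Continuous fun x => φ.out (a x) (b x) (κ x) (e x) :=
  φ.continuous_out.comp (ha.prodMk (hb.prodMk (hκ.prodMk he)))

/-- The rule of the Robinson–Schensted–Knuth correspondence: reflect the entry in the interval and
leave the carry unchanged. -/
def rskRule : LocalRule where
  out a b κ _ := a + b - κ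
  continuous_out := by fun_prop
  out_mem h1 h2 _ := ⟨by linarith, by linarith⟩
  carry_nonneg _ _ h := by linarith
  lintegral_out a b h hh := by
    have key : ∀ κ e : ℝ, a + b - κ + e - (a + b - κ) = e := fun κ e => by ring
    simp only [key]
    rw [← lintegral_indicator measurableSet_Icc, ← lintegral_indicator measurableSet_Icc,
      ← lintegral_sub_left_eq_self _ (a + b)]
    refine lintegral_congr fun κ => ?_
    simp only [Set.indicator]
    have : κ ∈ Set.Icc a b ↔ a + b - κ ∈ Set.Icc a b := by
      simp only [Set.mem_Icc]
      constructor <;> rintro ⟨h1, h2⟩ <;> constructor <;> linarith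
    simp [this]

/-- The rule of the Burge correspondence. With `p = b - κ`, `q = out - a`, `d = b - a` it sends
`(p, e)` to `(q, e')` with `e' + q = e + p = s` and `q = min s d - p`: it reflects `p` in the
interval that `s` and `d` allow, and so preserves Lebesgue measure. -/
def burgeRule : LocalRule where
  out a _ κ e := min (a + e) κ
  continuous_out := by fun_prop
  out_mem h1 h2 h3 := ⟨le_min (by linarith) h1, (min_le_right _ _).trans h2⟩
  carry_nonneg {a b κ e} h1 h2 h3 := by have := min_le_left (a + e) κ; linarith
  lintegral_out a b h hh := by
    have e1 : ∀ κ : ℝ, ∫⁻ e in Set.Ici 0, h (min (a + e) κ, a + b - κ + e - min (a + e) κ) =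
        ∫⁻ s, (Set.Ici (b - κ)).indicator (fun s =>
          h (min (a + s - b + κ) κ, a + s - min (a + s - b + κ) κ)) s := by
      intro κ
      rw [← lintegral_indicator measurableSet_Ici, ← lintegral_sub_right_eq_self _ (b - κ)]
      refine lintegral_congr fun s => ?_
      simp only [Set.indicator, Set.mem_Ici, sub_nonneg]
      refine if_congr Iff.rfl ?_ rfl
      congr 2
      · congr 1; ring
      · congr 1; ring_nf
        ring_nf
    have e2 : ∀ o : ℝ, ∫⁻ e in Set.Ici 0, h (o, e) =
        ∫⁻ s, (Set.Ici (o - a)).indicator (fun s => h (o, a + s - o)) s := by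
      intro o
      rw [← lintegral_indicator measurableSet_Ici, ← lintegral_sub_right_eq_self _ (o - a)]
      refine lintegral_congr fun s => ?_
      simp only [Set.indicator, Set.mem_Ici, sub_nonneg]
      refine if_congr Iff.rfl ?_ rfl
      congr 2
      ring
    simp only [e1, e2]
    rw [← lintegral_indicator measurableSet_Icc, ← lintegral_indicator measurableSet_Icc]
    have m1 : Measurable (Function.uncurry fun κ s : ℝ => (Set.Icc a b).indicator (fun κ =>
        (Set.Ici (b - κ)).indicator (fun s =>
          h (min (a + s - b + κ) κ, a + s - min (a + s - b + κ) κ)) s) κ) := by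
      have : (Function.uncurry fun κ s : ℝ => (Set.Icc a b).indicator (fun κ =>
        (Set.Ici (b - κ)).indicator (fun s =>
          h (min (a + s - b + κ) κ, a + s - min (a + s - b + κ) κ)) s) κ) =
          {p : ℝ × ℝ | p.1 ∈ Set.Icc a b ∧ b - p.1 ≤ p.2}.indicator (fun p =>
            h (min (a + p.2 - b + p.1) p.1, a + p.2 - min (a + p.2 - b + p.1) p.1)) := by
        ext ⟨κ, s⟩
        simp only [Function.uncurry, Set.indicator, Set.mem_Icc, Set.mem_Ici, Set.mem_ofPred_eq]
        split_ifs <;> tauto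
      rw [this]
      refine Measurable.indicator (by fun_prop) ?_
      exact .inter (s₁ := {p : ℝ × ℝ | p.1 ∈ Set.Icc a b}) (s₂ := {p | b - p.1 ≤ p.2})
        (measurable_fst measurableSet_Icc) (measurableSet_le (by fun_prop) (by fun_prop))
    have m2 : Measurable (Function.uncurry fun o s : ℝ => (Set.Icc a b).indicator (fun o =>
        (Set.Ici (o - a)).indicator (fun s => h (o, a + s - o)) s) o) := by
      have : (Function.uncurry fun o s : ℝ => (Set.Icc a b).indicator (fun o =>
        (Set.Ici (o - a)).indicator (fun s => h (o, a + s - o)) s) o) =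
          {p : ℝ × ℝ | p.1 ∈ Set.Icc a b ∧ p.1 - a ≤ p.2}.indicator (fun p =>
            h (p.1, a + p.2 - p.1)) := by
        ext ⟨κ, s⟩
        simp only [Function.uncurry, Set.indicator, Set.mem_Icc, Set.mem_Ici, Set.mem_ofPred_eq]
        split_ifs <;> tauto
      rw [this]
      refine Measurable.indicator (by fun_prop) ?_
      exact .inter (s₁ := {p : ℝ × ℝ | p.1 ∈ Set.Icc a b}) (s₂ := {p | p.1 - a ≤ p.2})
        (measurable_fst measurableSet_Icc) (measurableSet_le (by fun_prop) (by fun_prop))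
    have s1 : ∀ κ : ℝ, (Set.Icc a b).indicator (fun κ => ∫⁻ s, (Set.Ici (b - κ)).indicator (fun s =>
          h (min (a + s - b + κ) κ, a + s - min (a + s - b + κ) κ)) s) κ =
        ∫⁻ s, (Set.Icc a b).indicator (fun κ => (Set.Ici (b - κ)).indicator (fun s =>
          h (min (a + s - b + κ) κ, a + s - min (a + s - b + κ) κ)) s) κ := by
      intro κ; by_cases hκ : κ ∈ Set.Icc a b <;> simp [hκ]
    have s2 : ∀ o : ℝ, (Set.Icc a b).indicator (fun o => ∫⁻ s, (Set.Ici (o - a)).indicator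
          (fun s => h (o, a + s - o)) s) o =
        ∫⁻ s, (Set.Icc a b).indicator (fun o => (Set.Ici (o - a)).indicator
          (fun s => h (o, a + s - o)) s) o := by
      intro κ; by_cases hκ : κ ∈ Set.Icc a b <;> simp [hκ]
    simp only [s1, s2]
    rw [lintegral_lintegral_swap m1.aemeasurable, lintegral_lintegral_swap m2.aemeasurable]
    refine lintegral_congr fun s => ?_
    -- for fixed `s` the new entry is the old one translated by `min (a + s - b) 0`
    conv_rhs => rw [← lintegral_add_right_eq_self _ (min (a + s - b) 0)]
    refine lintegral_congr fun κ => ?_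
    have hmin : min (a + s - b + κ) κ = κ + min (a + s - b) 0 := by
      rw [add_comm κ, ← min_add_add_right, zero_add]
    simp only [Set.indicator, Set.mem_Icc, Set.mem_Ici, hmin, ← ite_and]
    refine if_congr ?_ rfl rfl
    rcases min_cases (a + s - b) 0 with ⟨h1, h2⟩ | ⟨h1, h2⟩ <;> rw [h1] <;>
      constructor <;> rintro ⟨⟨h3, h4⟩, h5⟩ <;> refine ⟨⟨?_, ?_⟩, ?_⟩ <;> linarith

/-- The carry left after the entries `κ (m - 1), …, κ 0`, each confined to its interval
`[a l, b l]`, have been processed in this order, starting from the carry `c`. -/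
def carryOut (φ : LocalRule) : ℕ → (ℕ → ℝ) → (ℕ → ℝ) → (ℕ → ℝ) → ℝ → ℝ
  | 0, _, _, _, c => c
  | m + 1, a, b, κ, c =>
    a 0 + b 0 - κ 0 + carryOut φ m (seqTail a) (seqTail b) (seqTail κ) c -
      φ.out (a 0) (b 0) (κ 0) (carryOut φ m (seqTail a) (seqTail b) (seqTail κ) c)

/-- The new entries produced along with `carryOut`, followed by zeros. -/
def entriesOut (φ : LocalRule) : ℕ → (ℕ → ℝ) → (ℕ → ℝ) → (ℕ → ℝ) → ℝ → ℕ → ℝ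
  | 0, _, _, _, _ => 0
  | m + 1, a, b, κ, c =>
    seqCons (φ.out (a 0) (b 0) (κ 0) (carryOut φ m (seqTail a) (seqTail b) (seqTail κ) c))
      (entriesOut φ m (seqTail a) (seqTail b) (seqTail κ) c)

@[fun_prop]
theorem continuous_carryOut (φ : LocalRule) {α : Type*} [TopologicalSpace α] (m : ℕ) :
    ∀ {a b κ : α → ℕ → ℝ} {c : α → ℝ}, Continuous a → Continuous b → Continuous κ →
      Continuous c → Continuous fun x => carryOut φ m (a x) (b x) (κ x) (c x) := by
  induction m with
  | zero => intro a b κ c _ _ _ hc; exact hc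
  | succ m ih =>
    intro a b κ c ha hb hκ hc
    have h := ih ha.seqTail hb.seqTail hκ.seqTail hc
    simp only [carryOut]
    fun_prop

@[fun_prop]
theorem continuous_entriesOut (φ : LocalRule) {α : Type*} [TopologicalSpace α] (m : ℕ) :
    ∀ {a b κ : α → ℕ → ℝ} {c : α → ℝ}, Continuous a → Continuous b → Continuous κ →
      Continuous c → Continuous fun x => entriesOut φ m (a x) (b x) (κ x) (c x) := by
  induction m with
  | zero => intro a b κ c _ _ _ hc; exact continuous_const
  | succ m ih =>
    intro a b κ c ha hb hκ hc
    have h := ih ha.seqTail hb.seqTail hκ.seqTail hc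
    have h2 := continuous_carryOut φ m ha.seqTail hb.seqTail hκ.seqTail hc
    simp only [entriesOut]
    fun_prop

/-- The sequences whose first `m` entries lie in the intervals `[a l, b l]`. -/
def box (m : ℕ) (a b : ℕ → ℝ) : Set (ℕ → ℝ) := {κ | ∀ l < m, a l ≤ κ l ∧ κ l ≤ b l}

theorem mem_box_succ {m : ℕ} {a b κ : ℕ → ℝ} : κ ∈ box (m + 1) a b ↔
    (a 0 ≤ κ 0 ∧ κ 0 ≤ b 0) ∧ seqTail κ ∈ box m (seqTail a) (seqTail b) := by
  simp only [box, Set.mem_ofPred_eq, seqTail_apply]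
  constructor
  · exact fun h => ⟨h 0 (by omega), fun l hl => h (l + 1) (by omega)⟩
  · rintro ⟨h0, h⟩ l hl
    cases l with
    | zero => exact h0
    | succ l => exact h l (by omega)

theorem measurableSet_box (m : ℕ) (a b : ℕ → ℝ) : MeasurableSet (box m a b) := by
  simp only [box, Set.ofPred_forall]
  exact .iInter fun l => .iInter fun _ =>
    .inter (s₁ := {κ : ℕ → ℝ | a l ≤ κ l}) (s₂ := {κ | κ l ≤ b l})
      (measurableSet_le (by fun_prop) (by fun_prop))
      (measurableSet_le (by fun_prop) (by fun_prop))

theorem carryOut_nonneg (φ : LocalRule) (m : ℕ) : ∀ {a b κ : ℕ → ℝ} {c : ℝ}, κ ∈ box m a b →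
    0 ≤ c → 0 ≤ carryOut φ m a b κ c := by
  induction m with
  | zero => intro a b κ c _ hc; exact hc
  | succ m ih =>
    intro a b κ c h hc
    obtain ⟨⟨h1, h2⟩, h3⟩ := mem_box_succ.1 h
    exact φ.carry_nonneg h1 h2 (ih h3 hc)

theorem entriesOut_mem_box (φ : LocalRule) (m : ℕ) : ∀ {a b κ : ℕ → ℝ} {c : ℝ}, κ ∈ box m a b →
    0 ≤ c → entriesOut φ m a b κ c ∈ box m a b := by
  induction m with
  | zero => intro a b κ c _ hc l hl; omega
  | succ m ih =>
    intro a b κ c h hc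
    obtain ⟨⟨h1, h2⟩, h3⟩ := mem_box_succ.1 h
    exact mem_box_succ.2 ⟨φ.out_mem h1 h2 (carryOut_nonneg φ m h3 hc), ih h3 hc⟩

theorem entriesOut_of_le (φ : LocalRule) (m : ℕ) : ∀ {a b κ : ℕ → ℝ} {c : ℝ} {l : ℕ}, m ≤ l →
    entriesOut φ m a b κ c l = 0 := by
  induction m with
  | zero => intros; rfl
  | succ m ih =>
    intro a b κ c l hl
    obtain ⟨l, rfl⟩ : ∃ k, l = k + 1 := ⟨l - 1, by omega⟩
    exact ih (by omega)

/-- The carry and the entries have a conserved total. -/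
theorem carryOut_add_sum (φ : LocalRule) (m : ℕ) : ∀ (a b κ : ℕ → ℝ) (c : ℝ),
    carryOut φ m a b κ c + ∑ l ∈ Finset.range m, entriesOut φ m a b κ c l =
      c + ∑ l ∈ Finset.range m, (a l + b l - κ l) := by
  induction m with
  | zero => intros; simp [carryOut]
  | succ m ih =>
    intro a b κ c
    have h := ih (seqTail a) (seqTail b) (seqTail κ) c
    rw [Finset.sum_range_succ', Finset.sum_range_succ']
    simp only [carryOut, entriesOut, seqCons_succ, seqCons_zero, seqTail_apply] at h ⊢
    linarith

/-! ### Lebesgue measure on the first entries of a sequence -/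

/-- Lebesgue measure on the first `m` entries of a sequence, the other entries being zero. -/
noncomputable def seqVol : ℕ → Measure (ℕ → ℝ)
  | 0 => Measure.dirac 0
  | m + 1 => ((volume : Measure ℝ).prod (seqVol m)).map fun p => seqCons p.1 p.2

instance sFinite_seqVol (m : ℕ) : SFinite (seqVol m) := by
  induction m with
  | zero => rw [seqVol]; infer_instance
  | succ m ih => rw [seqVol]; infer_instance

theorem lintegral_seqVol_succ (m : ℕ) {f : (ℕ → ℝ) → ℝ≥0∞} (hf : Measurable f) :
    ∫⁻ s, f s ∂seqVol (m + 1) = ∫⁻ x, ∫⁻ s, f (seqCons x s) ∂seqVol m := by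
  rw [seqVol, lintegral_map hf measurable_seqCons,
    lintegral_prod (fun p : ℝ × (ℕ → ℝ) => f (seqCons p.1 p.2))
      (hf.comp measurable_seqCons).aemeasurable]

theorem setLIntegral_box_succ (m : ℕ) (a b : ℕ → ℝ) {f : (ℕ → ℝ) → ℝ≥0∞} (hf : Measurable f) :
    ∫⁻ s in box (m + 1) a b, f s ∂seqVol (m + 1) =
      ∫⁻ x in Set.Icc (a 0) (b 0), ∫⁻ s in box m (seqTail a) (seqTail b),
        f (seqCons x s) ∂seqVol m := by
  rw [← lintegral_indicator (measurableSet_box _ _ _),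
    lintegral_seqVol_succ m (hf.indicator (measurableSet_box _ _ _)),
    ← lintegral_indicator measurableSet_Icc]
  refine lintegral_congr fun x => ?_
  by_cases hx : x ∈ Set.Icc (a 0) (b 0)
  · rw [Set.indicator_of_mem hx, ← lintegral_indicator (measurableSet_box _ _ _)]
    refine lintegral_congr fun s => ?_
    have : seqCons x s ∈ box (m + 1) a b ↔ s ∈ box m (seqTail a) (seqTail b) := by
      rw [mem_box_succ]; simp [Set.mem_Icc.1 hx]
    by_cases hs : s ∈ box m (seqTail a) (seqTail b)
    · rw [Set.indicator_of_mem hs, Set.indicator_of_mem (this.2 hs)]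
    · rw [Set.indicator_of_notMem hs, Set.indicator_of_notMem (this.not.2 hs)]
  · rw [Set.indicator_of_notMem hx]
    refine (lintegral_congr fun s => ?_).trans lintegral_zero
    refine Set.indicator_of_notMem ?_ _
    rw [mem_box_succ]
    exact fun h => hx h.1

/-- Processing all entries preserves Lebesgue measure on the product of the box and `[0, ∞)`. -/
theorem lintegral_carryOut (φ : LocalRule) (m : ℕ) : ∀ (a b : ℕ → ℝ)
    (g : ℝ × (ℕ → ℝ) → ℝ≥0∞), Measurable g →
    ∫⁻ κ in box m a b, (∫⁻ c in Set.Ici 0, g (carryOut φ m a b κ c, entriesOut φ m a b κ c))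
      ∂seqVol m = ∫⁻ e in Set.Ici 0, ∫⁻ s in box m a b, g (e, s) ∂seqVol m := by
  induction m with
  | zero =>
    intro a b g hg
    have hb : box 0 a b = Set.univ := by ext; simp [box]
    simp only [hb, Measure.restrict_univ, seqVol, carryOut, entriesOut]
    rw [lintegral_dirac]
    refine lintegral_congr fun e => ?_
    exact (lintegral_dirac' (f := fun s => g (e, s)) 0 (hg.comp measurable_prodMk_left)).symm
  | succ m ih =>
    intro a b g hg
    have hc : Measurable fun p : (ℕ → ℝ) × ℝ =>
        g (carryOut φ (m + 1) a b p.1 p.2, entriesOut φ (m + 1) a b p.1 p.2) :=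
      hg.comp (Continuous.measurable (by fun_prop))
    rw [setLIntegral_box_succ m a b hc.lintegral_prod_right']
    have step : ∀ x : ℝ, ∫⁻ s in box m (seqTail a) (seqTail b), (∫⁻ c in Set.Ici 0,
        g (carryOut φ (m + 1) a b (seqCons x s) c, entriesOut φ (m + 1) a b (seqCons x s) c))
          ∂seqVol m =
        ∫⁻ e in Set.Ici 0, ∫⁻ s in box m (seqTail a) (seqTail b),
          g (a 0 + b 0 - x + e - φ.out (a 0) (b 0) x e,
            seqCons (φ.out (a 0) (b 0) x e) s) ∂seqVol m := by
      intro x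
      refine ih (seqTail a) (seqTail b) (fun p => g (a 0 + b 0 - x + p.1 -
        φ.out (a 0) (b 0) x p.1, seqCons (φ.out (a 0) (b 0) x p.1) p.2)) ?_
      exact hg.comp (Continuous.measurable (by fun_prop))
    simp only [step]
    have hG : Measurable fun p : (ℝ × ℝ) × (ℕ → ℝ) => g (p.1.2, seqCons p.1.1 p.2) :=
      hg.comp (Continuous.measurable (by fun_prop))
    rw [φ.lintegral_out (a 0) (b 0) (fun p => ∫⁻ s in box m (seqTail a) (seqTail b),
      g (p.2, seqCons p.1 s) ∂seqVol m) hG.lintegral_prod_right']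
    rw [lintegral_lintegral_swap (f := fun o e => ∫⁻ s in box m (seqTail a) (seqTail b),
      g (e, seqCons o s) ∂seqVol m) (Measurable.aemeasurable hG.lintegral_prod_right')]
    refine lintegral_congr fun e => ?_
    exact (setLIntegral_box_succ m a b (f := fun s => g (e, s))
      (hg.comp measurable_prodMk_left)).symm

end LPP

namespace LPP

open scoped ENNReal Classical

/-! ### Inserting a weight into one level of a pattern -/

/-- Left ends of the intervals that confine the entries of a new level, given the old level `σ`
with `m + 1` entries and the new level `μ` with `m` entries below it. -/
noncomputable def lowerEnds (m : ℕ) (σ μ : ℕ → ℝ) : ℕ → ℝ :=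
  fun l => if l < m then max (σ l) (μ l) else σ l

/-- Right ends of these intervals; the one for the entry `l + 1` has index `l`, and the entry `0`
is not bounded above. -/
noncomputable def upperEnds (σ μ : ℕ → ℝ) : ℕ → ℝ := fun l => min (σ l) (μ l)

/-- The new level with `m + 1` entries, when the weight `c` is inserted at the old level `σ`; the
level below was `κ` and has become `μ`. -/
noncomputable def insertLevel (φ : LocalRule) (m : ℕ) (κ σ μ : ℕ → ℝ) (c : ℝ) : ℕ → ℝ :=
  seqCons (lowerEnds m σ μ 0 + carryOut φ m (seqTail (lowerEnds m σ μ)) (upperEnds σ μ) κ c)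
    (entriesOut φ m (seqTail (lowerEnds m σ μ)) (upperEnds σ μ) κ c)

@[fun_prop]
theorem continuous_insertLevel (φ : LocalRule) (m : ℕ) {α : Type*} [TopologicalSpace α]
    {κ σ μ : α → ℕ → ℝ} {c : α → ℝ} (hκ : Continuous κ) (hσ : Continuous σ) (hμ : Continuous μ)
    (hc : Continuous c) : Continuous fun x => insertLevel φ m (κ x) (σ x) (μ x) (c x) := by
  have h1 : Continuous fun x => lowerEnds m (σ x) (μ x) := by
    refine continuous_pi fun l => ?_
    unfold lowerEnds
    split_ifs <;> fun_prop
  have h2 : Continuous fun x => upperEnds (σ x) (μ x) := by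
    refine continuous_pi fun l => ?_
    unfold upperEnds
    fun_prop
  unfold insertLevel
  fun_prop

/-- The `m` entries of `κ` interlace the first `m + 1` entries of `σ`. -/
def Interlaces (m : ℕ) (κ σ : ℕ → ℝ) : Prop := ∀ l < m, σ (l + 1) ≤ κ l ∧ κ l ≤ σ l

/-- The first `m` entries of `σ'` grow out of those of `σ` by a horizontal strip:
`σ 0 ≤ σ' 0` and `σ (l + 1) ≤ σ' (l + 1) ≤ σ l`. -/
def StripBelow (m : ℕ) (σ σ' : ℕ → ℝ) : Prop :=
  ∀ l < m, σ l ≤ σ' l ∧ (l + 1 < m → σ' (l + 1) ≤ σ l)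

theorem interlaces_and_stripBelow_iff {m : ℕ} {κ σ μ : ℕ → ℝ} :
    Interlaces m κ σ ∧ StripBelow m κ μ ↔
      κ ∈ box m (seqTail (lowerEnds m σ μ)) (upperEnds σ μ) := by
  simp only [Interlaces, StripBelow, box, Set.mem_ofPred_eq, seqTail_apply, lowerEnds, upperEnds,
    le_min_iff]
  constructor
  · rintro ⟨h1, h2⟩ l hl
    refine ⟨?_, (h1 l hl).2, (h2 l hl).1⟩
    split_ifs with h
    · exact max_le (h1 l hl).1 ((h2 l hl).2 h)
    · exact (h1 l hl).1
  · intro h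
    refine ⟨fun l hl => ⟨?_, (h l hl).2.1⟩, fun l hl => ⟨(h l hl).2.2, fun h3 => ?_⟩⟩
    · have := (h l hl).1
      split_ifs at this
      · exact (le_max_left _ _).trans this
      · exact this
    · have := (h l hl).1
      rw [if_pos h3] at this
      exact (le_max_right _ _).trans this

theorem stripBelow_and_interlaces_iff {m : ℕ} {σ μ σ' : ℕ → ℝ} :
    StripBelow (m + 1) σ σ' ∧ Interlaces m μ σ' ↔ lowerEnds m σ μ 0 ≤ σ' 0 ∧
      seqTail σ' ∈ box m (seqTail (lowerEnds m σ μ)) (upperEnds σ μ) := by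
  have key : (∀ l < m + 1, lowerEnds m σ μ l ≤ σ' l) ↔
      (∀ l < m + 1, σ l ≤ σ' l) ∧ ∀ l < m, μ l ≤ σ' l := by
    simp only [lowerEnds]
    constructor
    · intro h
      refine ⟨fun l hl => ?_, fun l hl => ?_⟩
      · have := h l hl
        split_ifs at this
        · exact (le_max_left _ _).trans this
        · exact this
      · have := h l (by omega)
        rw [if_pos hl] at this
        exact (le_max_right _ _).trans this
    · rintro ⟨h1, h2⟩ l hl
      split_ifs with h
      · exact max_le (h1 l hl) (h2 l h)
      · exact h1 l hl
  have key2 : (∀ l < m + 1, lowerEnds m σ μ l ≤ σ' l) ↔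
      lowerEnds m σ μ 0 ≤ σ' 0 ∧ ∀ l < m, lowerEnds m σ μ (l + 1) ≤ σ' (l + 1) := by
    constructor
    · exact fun h => ⟨h 0 (by omega), fun l hl => h (l + 1) (by omega)⟩
    · rintro ⟨h0, h⟩ l hl
      cases l with
      | zero => exact h0
      | succ l => exact h l (by omega)
  simp only [Interlaces, StripBelow, box, Set.mem_ofPred_eq, seqTail_apply, upperEnds, le_min_iff]
  constructor
  · rintro ⟨h1, h2⟩
    obtain ⟨h3, h4⟩ := key2.1 (key.2 ⟨fun l hl => (h1 l hl).1, fun l hl => (h2 l hl).2⟩)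
    exact ⟨h3, fun l hl => ⟨h4 l hl, (h1 l (by omega)).2 (by omega), (h2 l hl).1⟩⟩
  · rintro ⟨h1, h2⟩
    obtain ⟨h3, h4⟩ := key.1 (key2.2 ⟨h1, fun l hl => (h2 l hl).1⟩)
    exact ⟨fun l hl => ⟨h3 l hl, fun h => (h2 l (by omega)).2.1⟩,
      fun l hl => ⟨(h2 l hl).2.2, h4 l hl⟩⟩

/-- Inserting a nonnegative weight preserves the interlacing, and the new level is obtained from
the old one by a horizontal strip. -/
theorem insertLevel_spec (φ : LocalRule) {m : ℕ} {κ σ μ : ℕ → ℝ} {c : ℝ} (hc : 0 ≤ c)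
    (h1 : Interlaces m κ σ) (h2 : StripBelow m κ μ) :
    StripBelow (m + 1) σ (insertLevel φ m κ σ μ c) ∧
      Interlaces m μ (insertLevel φ m κ σ μ c) := by
  have h := interlaces_and_stripBelow_iff.1 ⟨h1, h2⟩
  refine stripBelow_and_interlaces_iff.2 ⟨?_, entriesOut_mem_box φ m h hc⟩
  have := carryOut_nonneg φ m h hc
  simp only [insertLevel, seqCons_zero]
  linarith

theorem sum_insertLevel (φ : LocalRule) (m : ℕ) (κ σ μ : ℕ → ℝ) (c : ℝ) :
    ∑ l ∈ Finset.range (m + 1), insertLevel φ m κ σ μ c l =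
      c + ∑ l ∈ Finset.range (m + 1), σ l + ∑ l ∈ Finset.range m, μ l -
        ∑ l ∈ Finset.range m, κ l := by
  have h := carryOut_add_sum φ m (seqTail (lowerEnds m σ μ)) (upperEnds σ μ) κ c
  have h1 : ∑ l ∈ Finset.range (m + 1), lowerEnds m σ μ l =
      ∑ l ∈ Finset.range m, max (σ l) (μ l) + σ m := by
    rw [Finset.sum_range_succ]
    congr 1
    · exact Finset.sum_congr rfl fun l hl => if_pos (Finset.mem_range.1 hl)
    · exact if_neg (lt_irrefl m)
  have h2 : ∑ l ∈ Finset.range m, max (σ l) (μ l) + ∑ l ∈ Finset.range m, upperEnds σ μ l =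
      ∑ l ∈ Finset.range m, σ l + ∑ l ∈ Finset.range m, μ l := by
    rw [← Finset.sum_add_distrib, ← Finset.sum_add_distrib]
    exact Finset.sum_congr rfl fun l _ => max_add_min _ _
  rw [Finset.sum_range_succ'] at h1
  simp only [Finset.sum_add_distrib, Finset.sum_sub_distrib, seqTail_apply] at h
  rw [Finset.sum_range_succ', Finset.sum_range_succ]
  simp only [insertLevel, seqCons_succ, seqCons_zero]
  linarith

/-- Indicator of the interlacing relation. -/
noncomputable def interlaceInd (m : ℕ) (κ σ : ℕ → ℝ) : ℝ≥0∞ := if Interlaces m κ σ then 1 else 0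

/-- The density `r ^ m * exp (-r (|σ'| - |σ|))` of a growth step from `σ` to `σ'`. -/
noncomputable def stepDensity (r : ℝ) (m : ℕ) (σ σ' : ℕ → ℝ) : ℝ≥0∞ :=
  if StripBelow m σ σ' then ENNReal.ofReal (r ^ m * Real.exp (-(r *
    (∑ l ∈ Finset.range m, σ' l - ∑ l ∈ Finset.range m, σ l)))) else 0

theorem measurableSet_interlaces (m : ℕ) {α : Type*} [MeasurableSpace α] {f g : α → ℕ → ℝ}
    (hf : Measurable f) (hg : Measurable g) : MeasurableSet {x | Interlaces m (f x) (g x)} := by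
  have hf' : ∀ l, Measurable fun x => f x l := fun l => (measurable_pi_apply l).comp hf
  have hg' : ∀ l, Measurable fun x => g x l := fun l => (measurable_pi_apply l).comp hg
  simp only [Interlaces, Set.ofPred_forall]
  exact .iInter fun l => .iInter fun _ =>
    .inter (s₁ := {x | g x (l + 1) ≤ f x l}) (s₂ := {x | f x l ≤ g x l})
      (measurableSet_le (hg' _) (hf' _)) (measurableSet_le (hf' _) (hg' _))

theorem measurableSet_stripBelow (m : ℕ) {α : Type*} [MeasurableSpace α] {f g : α → ℕ → ℝ}
    (hf : Measurable f) (hg : Measurable g) : MeasurableSet {x | StripBelow m (f x) (g x)} := by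
  have hf' : ∀ l, Measurable fun x => f x l := fun l => (measurable_pi_apply l).comp hf
  have hg' : ∀ l, Measurable fun x => g x l := fun l => (measurable_pi_apply l).comp hg
  simp only [StripBelow, Set.ofPred_forall]
  refine .iInter fun l => .iInter fun _ =>
    .inter (s₁ := {x | f x l ≤ g x l}) (s₂ := {x | l + 1 < m → g x (l + 1) ≤ f x l})
      (measurableSet_le (hf' _) (hg' _)) ?_
  simp only [Set.ofPred_forall]
  exact .iInter fun _ => measurableSet_le (hg' _) (hf' _)

@[fun_prop]
theorem measurable_interlaceInd (m : ℕ) {α : Type*} [MeasurableSpace α] {f g : α → ℕ → ℝ}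
    (hf : Measurable f) (hg : Measurable g) : Measurable fun x => interlaceInd m (f x) (g x) :=
  .ite (measurableSet_interlaces m hf hg) measurable_const measurable_const

@[fun_prop]
theorem measurable_stepDensity (r : ℝ) (m : ℕ) {α : Type*} [MeasurableSpace α] {f g : α → ℕ → ℝ}
    (hf : Measurable f) (hg : Measurable g) : Measurable fun x => stepDensity r m (f x) (g x) := by
  have hf' : ∀ l, Measurable fun x => f x l := fun l => (measurable_pi_apply l).comp hf
  have hg' : ∀ l, Measurable fun x => g x l := fun l => (measurable_pi_apply l).comp hg
  exact .ite (measurableSet_stripBelow m hf hg) (by fun_prop) measurable_const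

theorem lintegral_expMeasure (r : ℝ) {g : ℝ → ℝ≥0∞} (hg : Measurable g) :
    ∫⁻ c, g c ∂expMeasure r =
      ∫⁻ c in Set.Ici 0, ENNReal.ofReal (r * Real.exp (-(r * c))) * g c := by
  have hm : Measurable (exponentialPDF r) := (measurable_exponentialPDFReal r).ennreal_ofReal
  change ∫⁻ c, g c ∂(volume.withDensity (exponentialPDF r)) = _
  rw [lintegral_withDensity_eq_lintegral_mul _ hm hg, ← lintegral_indicator measurableSet_Ici]
  refine lintegral_congr fun c => ?_
  by_cases hc : 0 ≤ c
  · rw [Set.indicator_of_mem (Set.mem_Ici.2 hc), Pi.mul_apply, exponentialPDF_of_nonneg hc]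
  · rw [Set.indicator_of_notMem (by simpa using hc), Pi.mul_apply,
      exponentialPDF_of_neg (not_le.1 hc), zero_mul]

/-- The one-level identity behind the whole argument: integrating over the old lower level `κ` and
over the inserted exponential weight gives a measure on the new level that does not depend on the
local rule. -/
theorem lintegral_insertLevel (φ : LocalRule) {r : ℝ} (hr : 0 < r) (m : ℕ) (σ μ : ℕ → ℝ)
    {g : (ℕ → ℝ) → ℝ≥0∞} (hg : Measurable g) :
    ∫⁻ κ, stepDensity r m κ μ * (interlaceInd m κ σ *
      ∫⁻ c, g (insertLevel φ m κ σ μ c) ∂expMeasure r) ∂seqVol m =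
    ∫⁻ σ', stepDensity r (m + 1) σ σ' * (interlaceInd m μ σ' * g σ') ∂seqVol (m + 1) := by
  set a := lowerEnds m σ μ with ha
  set b := upperEnds σ μ with hb
  -- both sides are integrals of the same function `G` of the carry and the new entries
  set G : ℝ × (ℕ → ℝ) → ℝ≥0∞ := fun p => ENNReal.ofReal (r ^ (m + 1) * Real.exp (-(r *
    (∑ l ∈ Finset.range (m + 1), seqCons (a 0 + p.1) p.2 l - ∑ l ∈ Finset.range (m + 1), σ l)))) *
      g (seqCons (a 0 + p.1) p.2) with hG
  have hcons : Measurable fun p : ℝ × (ℕ → ℝ) => seqCons (a 0 + p.1) p.2 :=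
    Continuous.measurable (by fun_prop)
  have hGm : Measurable G := by
    refine Measurable.mul ?_ (hg.comp hcons)
    have : ∀ l, Measurable fun p : ℝ × (ℕ → ℝ) => seqCons (a 0 + p.1) p.2 l :=
      fun l => (measurable_pi_apply l).comp hcons
    fun_prop
  have hL : ∀ κ, stepDensity r m κ μ * (interlaceInd m κ σ *
      ∫⁻ c, g (insertLevel φ m κ σ μ c) ∂expMeasure r) = (box m (seqTail a) b).indicator
        (fun κ => ∫⁻ c in Set.Ici 0,
          G (carryOut φ m (seqTail a) b κ c, entriesOut φ m (seqTail a) b κ c)) κ := by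
    intro κ
    by_cases hκ : κ ∈ box m (seqTail a) b
    · obtain ⟨h1, h2⟩ := interlaces_and_stripBelow_iff.2 hκ
      have hins : Measurable fun c => g (insertLevel φ m κ σ μ c) :=
        hg.comp (Continuous.measurable (by fun_prop))
      rw [Set.indicator_of_mem hκ, stepDensity, if_pos h2, interlaceInd, if_pos h1, one_mul,
        lintegral_expMeasure r hins, ← lintegral_const_mul _ (by fun_prop)]
      refine setLIntegral_congr_fun measurableSet_Ici fun c _ => ?_
      simp only [hG]
      have hs := sum_insertLevel φ m κ σ μ c
      simp only [insertLevel] at hs ⊢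
      rw [← mul_assoc, ← ENNReal.ofReal_mul (by positivity), hs]
      congr 2
      rw [mul_mul_mul_comm, ← pow_succ, ← Real.exp_add]
      congr 2
      ring
    · have h := interlaces_and_stripBelow_iff.not.2 hκ
      rw [Set.indicator_of_notMem hκ, stepDensity, interlaceInd]
      split_ifs with h1 h2 <;> simp
      exact absurd ⟨h2, h1⟩ h
  have hR : ∀ (x : ℝ) (s : ℕ → ℝ), stepDensity r (m + 1) σ (seqCons x s) *
      (interlaceInd m μ (seqCons x s) * g (seqCons x s)) = (Set.Ici (a 0)).indicator (fun x =>
        (box m (seqTail a) b).indicator (fun s => G (x - a 0, s)) s) x := by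
    intro x s
    have hiff := stripBelow_and_interlaces_iff (m := m) (σ := σ) (μ := μ) (σ' := seqCons x s)
    rw [seqTail_seqCons, seqCons_zero] at hiff
    by_cases h : StripBelow (m + 1) σ (seqCons x s) ∧ Interlaces m μ (seqCons x s)
    · obtain ⟨h1, h2⟩ := hiff.1 h
      rw [Set.indicator_of_mem (Set.mem_Ici.2 h1), Set.indicator_of_mem h2, stepDensity, if_pos h.1,
        interlaceInd, if_pos h.2, one_mul]
      simp only [hG, add_sub_cancel]
    · have h' := hiff.not.1 h
      rw [stepDensity, interlaceInd, Set.indicator, Set.indicator]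
      simp only [Set.mem_Ici]
      split_ifs <;> simp <;> tauto
  rw [lintegral_congr hL, lintegral_indicator (measurableSet_box _ _ _),
    lintegral_carryOut φ m _ _ G hGm, lintegral_seqVol_succ m (by fun_prop),
    ← lintegral_indicator measurableSet_Ici, ← lintegral_sub_right_eq_self _ (a 0)]
  refine lintegral_congr fun x => ?_
  simp only [hR]
  by_cases hx : x ∈ Set.Ici (a 0)
  · have hx' : x - a 0 ∈ Set.Ici (0 : ℝ) := by simpa using hx
    simp only [Set.indicator_of_mem hx, Set.indicator_of_mem hx']
    rw [lintegral_indicator (measurableSet_box _ _ _)]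
  · have hx' : x - a 0 ∉ Set.Ici (0 : ℝ) := by simpa using hx
    simp only [Set.indicator_of_notMem hx, Set.indicator_of_notMem hx', lintegral_zero]

/-! ### Finite towers -/

/-- Tuples of length `K` whose `k`-th entry lies in `E k`, as iterated products. -/
def Tower (E : ℕ → Type) : ℕ → Type
  | 0 => Unit
  | K + 1 => Tower E K × E K

namespace Tower

variable {E : ℕ → Type}

instance instMeasurableSpace [∀ k, MeasurableSpace (E k)] : ∀ K, MeasurableSpace (Tower E K)
  | 0 => inferInstanceAs (MeasurableSpace Unit)
  | K + 1 => @Prod.instMeasurableSpace (Tower E K) (E K) (instMeasurableSpace K) _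

instance instTopologicalSpace [∀ k, TopologicalSpace (E k)] : ∀ K, TopologicalSpace (Tower E K)
  | 0 => inferInstanceAs (TopologicalSpace Unit)
  | K + 1 => @instTopologicalSpaceProd (Tower E K) (E K) (instTopologicalSpace K) _

instance instSecondCountableTopology [∀ k, TopologicalSpace (E k)]
    [∀ k, SecondCountableTopology (E k)] : ∀ K, SecondCountableTopology (Tower E K)
  | 0 => inferInstanceAs (SecondCountableTopology Unit)
  | K + 1 =>
    haveI := instSecondCountableTopology K
    inferInstanceAs (SecondCountableTopology (Tower E K × E K))

instance instBorelSpace [∀ k, TopologicalSpace (E k)] [∀ k, MeasurableSpace (E k)]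
    [∀ k, SecondCountableTopology (E k)] [∀ k, BorelSpace (E k)] : ∀ K, BorelSpace (Tower E K)
  | 0 => inferInstanceAs (BorelSpace Unit)
  | K + 1 =>
    haveI := instBorelSpace K
    inferInstanceAs (BorelSpace (Tower E K × E K))

/-- The product measure on a tower. -/
noncomputable def measure [∀ k, MeasurableSpace (E k)] (μ : ∀ k, Measure (E k)) :
    ∀ K, Measure (Tower E K)
  | 0 => Measure.dirac ()
  | K + 1 => (measure μ K).prod (μ K)

instance sFinite_measure [∀ k, MeasurableSpace (E k)] (μ : ∀ k, Measure (E k))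
    [∀ k, SFinite (μ k)] : ∀ K, SFinite (measure μ K)
  | 0 => inferInstanceAs (SFinite (Measure.dirac ()))
  | K + 1 =>
    haveI := sFinite_measure μ K
    inferInstanceAs (SFinite ((measure μ K).prod (μ K)))

instance isProbabilityMeasure_measure [∀ k, MeasurableSpace (E k)] (μ : ∀ k, Measure (E k))
    [∀ k, IsProbabilityMeasure (μ k)] : ∀ K, IsProbabilityMeasure (measure μ K)
  | 0 => inferInstanceAs (IsProbabilityMeasure (Measure.dirac ()))
  | K + 1 =>
    haveI := isProbabilityMeasure_measure μ K
    inferInstanceAs (IsProbabilityMeasure ((measure μ K).prod (μ K)))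

theorem lintegral_measure_zero [∀ k, MeasurableSpace (E k)] (μ : ∀ k, Measure (E k))
    (f : Tower E 0 → ℝ≥0∞) : ∫⁻ x, f x ∂measure μ 0 = f () :=
  lintegral_dirac (α := Unit) () f

theorem lintegral_measure_succ [∀ k, MeasurableSpace (E k)] (μ : ∀ k, Measure (E k))
    [∀ k, SFinite (μ k)] (K : ℕ) {f : Tower E (K + 1) → ℝ≥0∞} (hf : Measurable f) :
    ∫⁻ x, f x ∂measure μ (K + 1) = ∫⁻ x, ∫⁻ y, f (x, y) ∂μ K ∂measure μ K :=
  lintegral_prod (α := Tower E K) f hf.aemeasurable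

theorem lintegral_measure_succ_symm [∀ k, MeasurableSpace (E k)] (μ : ∀ k, Measure (E k))
    [∀ k, SFinite (μ k)] (K : ℕ) {f : Tower E (K + 1) → ℝ≥0∞} (hf : Measurable f) :
    ∫⁻ x, f x ∂measure μ (K + 1) = ∫⁻ y, ∫⁻ x, f (x, y) ∂measure μ K ∂μ K :=
  lintegral_prod_symm (α := Tower E K) f hf.aemeasurable

/-- The first `K` terms of a sequence. -/
def ofSeq (x : ∀ k, E k) : ∀ K, Tower E K
  | 0 => ()
  | K + 1 => (ofSeq x K, x K)

theorem ofSeq_congr {x y : ∀ k, E k} : ∀ {K : ℕ}, (∀ k < K, x k = y k) → ofSeq x K = ofSeq y K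
  | 0, _ => rfl
  | K + 1, h => by
    rw [ofSeq, ofSeq, ofSeq_congr fun k hk => h k (by omega), h K (by omega)]

end Tower

/-! ### Inserting a column into a pattern -/

/-- Triangular patterns with `K` levels; only the first `k + 1` entries of level `k` matter. -/
abbrev Pattern (K : ℕ) : Type := Tower (fun _ => ℕ → ℝ) K

/-- Columns of `K` weights. -/
abbrev Column (K : ℕ) : Type := Tower (fun _ => ℝ) K

namespace Pattern

/-- The last level of a pattern. -/
def top : ∀ {K : ℕ}, Pattern K → ℕ → ℝ
  | 0, _ => 0
  | _ + 1, T => T.2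

theorem continuous_top : ∀ {K : ℕ}, Continuous (top (K := K))
  | 0 => continuous_const
  | K + 1 => continuous_snd (X := Pattern K)

/-- Insertion of a column of weights, level by level. -/
noncomputable def insert (φ : LocalRule) : ∀ {K : ℕ}, Pattern K → Column K → Pattern K
  | 0, _, _ => ()
  | K + 1, T, c => (insert φ (K := K) T.1 c.1,
      insertLevel φ K (top (K := K) T.1) T.2 (top (insert φ (K := K) T.1 c.1)) c.2)

theorem continuous_insert (φ : LocalRule) :
    ∀ {K : ℕ}, Continuous fun p : Pattern K × Column K => insert φ p.1 p.2
  | 0 => continuous_const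
  | K + 1 => by
    have e1 : Continuous fun p : Pattern (K + 1) × Column (K + 1) => (p.1.1 : Pattern K) :=
      (continuous_fst (X := Pattern K) (Y := ℕ → ℝ)).comp continuous_fst
    have e2 : Continuous fun p : Pattern (K + 1) × Column (K + 1) => (p.1.2 : ℕ → ℝ) :=
      (continuous_snd (X := Pattern K) (Y := ℕ → ℝ)).comp continuous_fst
    have e3 : Continuous fun p : Pattern (K + 1) × Column (K + 1) => (p.2.1 : Column K) :=
      (continuous_fst (X := Column K) (Y := ℝ)).comp continuous_snd
    have e4 : Continuous fun p : Pattern (K + 1) × Column (K + 1) => (p.2.2 : ℝ) :=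
      (continuous_snd (X := Column K) (Y := ℝ)).comp continuous_snd
    have h : Continuous fun p : Pattern (K + 1) × Column (K + 1) =>
        insert φ (K := K) p.1.1 p.2.1 := (continuous_insert φ).comp (e1.prodMk e3)
    exact h.prodMk (continuous_insertLevel φ K (continuous_top.comp e1) e2
      (continuous_top.comp h) e4)

/-- Lebesgue measure on patterns. -/
noncomputable abbrev vol (K : ℕ) : Measure (Pattern K) := Tower.measure (fun k => seqVol (k + 1)) K

/-- Indicator of the Gelfand–Tsetlin patterns, those in which consecutive levels interlace. -/
noncomputable def ind : ∀ {K : ℕ}, Pattern K → ℝ≥0∞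
  | 0, _ => 1
  | K + 1, T => ind (K := K) T.1 * interlaceInd K (top (K := K) T.1) T.2

theorem measurable_ind : ∀ {K : ℕ}, Measurable (ind (K := K))
  | 0 => measurable_const
  | K + 1 => by
    have h1 : Measurable fun T : Pattern (K + 1) => (T.1 : Pattern K) :=
      measurable_fst (α := Pattern K) (β := ℕ → ℝ)
    have h2 : Measurable fun T : Pattern (K + 1) => (T.2 : ℕ → ℝ) :=
      measurable_snd (α := Pattern K) (β := ℕ → ℝ)
    exact (measurable_ind.comp h1).mul
      (measurable_interlaceInd K (continuous_top.measurable.comp h1) h2)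

/-- The law of a column of independent exponential weights. -/
noncomputable abbrev columnLaw (r : ℝ) (K : ℕ) : Measure (Column K) :=
  Tower.measure (fun _ => expMeasure r) K

/-- If a random pattern is uniform given its top level, then so it is after the insertion of an
exponential column, even jointly with the old top level, which evolves by `stepDensity`. The
right-hand side does not depend on the local rule. -/
theorem lintegral_insert (φ : LocalRule) {r : ℝ} (hr : 0 < r) : ∀ (K : ℕ)
    (G : (ℕ → ℝ) × Pattern K → ℝ≥0∞), Measurable G →
    ∫⁻ T, ind T * ∫⁻ c, G (top T, insert φ T c) ∂columnLaw r K ∂vol K =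
      ∫⁻ T, ind T * ∫⁻ σ, stepDensity r K σ (top T) * G (σ, T) ∂seqVol K ∂vol K := by
  have := isProbabilityMeasure_expMeasure hr
  intro K
  induction K with
  | zero =>
    intro G hG
    simp only [Tower.lintegral_measure_zero]
    have hm : Measurable fun σ => stepDensity r 0 σ (top (K := 0) ()) * G (σ, ()) :=
      (measurable_stepDensity r 0 measurable_id measurable_const).mul
        (hG.comp measurable_prodMk_right)
    rw [seqVol, lintegral_dirac' _ hm]
    simp [stepDensity, StripBelow, top, insert]
  | succ K ih =>
    intro G hG
    -- measurability of the ingredients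
    have mtop : Measurable (top (K := K)) := continuous_top.measurable
    have mind : Measurable (ind (K := K)) := measurable_ind
    have mins : Measurable fun p : Pattern K × Column K => insert φ p.1 p.2 :=
      (continuous_insert φ).measurable
    have mlev : Measurable fun p : (ℕ → ℝ) × (ℕ → ℝ) × (ℕ → ℝ) × ℝ =>
        insertLevel φ K p.1 p.2.1 p.2.2.1 p.2.2.2 := Continuous.measurable (by fun_prop)
    have mG : Measurable fun p : (ℕ → ℝ) × Pattern K × (ℕ → ℝ) =>
        G (p.1, ((p.2.1, p.2.2) : Pattern (K + 1))) := hG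
    -- the inner integral over the last weight
    set J : (ℕ → ℝ) → (ℕ → ℝ) → Pattern K → ℝ≥0∞ := fun σ κ T' =>
      ∫⁻ c, G (σ, ((T', insertLevel φ K κ σ (top T') c) : Pattern (K + 1))) ∂expMeasure r with hJ
    have mJ0 : Measurable fun p : ((ℕ → ℝ) × (ℕ → ℝ) × Pattern K) × ℝ =>
        G (p.1.1, ((p.1.2.2, insertLevel φ K p.1.2.1 p.1.1 (top p.1.2.2) p.2) :
          Pattern (K + 1))) := by
      refine mG.comp (f := fun p : ((ℕ → ℝ) × (ℕ → ℝ) × Pattern K) × ℝ => (p.1.1, p.1.2.2,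
        insertLevel φ K p.1.2.1 p.1.1 (top p.1.2.2) p.2)) ?_
      refine Measurable.prodMk (by fun_prop) (Measurable.prodMk (by fun_prop) ?_)
      exact mlev.comp (f := fun p : ((ℕ → ℝ) × (ℕ → ℝ) × Pattern K) × ℝ =>
        (p.1.2.1, p.1.1, top p.1.2.2, p.2)) (by fun_prop)
    have mJ : Measurable fun p : (ℕ → ℝ) × (ℕ → ℝ) × Pattern K => J p.1 p.2.1 p.2.2 :=
      mJ0.lintegral_prod_right'
    have e1 : ∀ (T : Pattern K) (σ : ℕ → ℝ),
        ∫⁻ c, G (σ, insert φ (K := K + 1) (T, σ) c) ∂columnLaw r (K + 1) =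
          ∫⁻ c, J σ (top T) (insert φ T c) ∂columnLaw r K := by
      intro T σ
      rw [Tower.lintegral_measure_succ]
      · rfl
      · refine hG.comp (Measurable.prodMk measurable_const ?_)
        exact (continuous_insert φ (K := K + 1)).measurable.comp measurable_prodMk_left
    have mLHS : Measurable fun T : Pattern (K + 1) => ind T * ∫⁻ c,
        G (top T, insert φ T c) ∂columnLaw r (K + 1) := by
      refine measurable_ind.mul (Measurable.lintegral_prod_right' (f := fun p :
        Pattern (K + 1) × Column (K + 1) => G (top p.1, insert φ p.1 p.2)) ?_)
      exact hG.comp ((continuous_top.measurable.comp measurable_fst).prodMk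
        (continuous_insert φ).measurable)
    have mRHS : Measurable fun T : Pattern (K + 1) => ind T * ∫⁻ σ,
        stepDensity r (K + 1) σ (top T) * G (σ, T) ∂seqVol (K + 1) := by
      refine measurable_ind.mul (Measurable.lintegral_prod_right' (f := fun p :
        Pattern (K + 1) × (ℕ → ℝ) => stepDensity r (K + 1) p.2 (top p.1) * G (p.2, p.1)) ?_)
      exact (measurable_stepDensity r (K + 1) measurable_snd
        (continuous_top.measurable.comp measurable_fst)).mul (hG.comp measurable_swap)
    -- the inner integral over the new level
    set R : (ℕ → ℝ) → Pattern K → (ℕ → ℝ) → ℝ≥0∞ := fun σ T' σ' =>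
      stepDensity r (K + 1) σ σ' * (interlaceInd K (top T') σ' *
        G (σ, ((T', σ') : Pattern (K + 1)))) with hR
    have mR : Measurable fun p : (ℕ → ℝ) × Pattern K × (ℕ → ℝ) => R p.1 p.2.1 p.2.2 := by
      refine Measurable.mul (by fun_prop) (Measurable.mul (by fun_prop) mG)
    have step : ∀ σ : ℕ → ℝ, ∫⁻ T : Pattern K, ind (K := K + 1) (T, σ) *
          ∫⁻ c, G (σ, insert φ (K := K + 1) (T, σ) c) ∂columnLaw r (K + 1) ∂vol K =
        ∫⁻ T : Pattern K, ind T * ∫⁻ σ', R σ T σ' ∂seqVol (K + 1) ∂vol K := by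
      intro σ
      have mS : Measurable fun p : (ℕ → ℝ) × Pattern K =>
          interlaceInd K p.1 σ * J σ p.1 p.2 := by
        refine Measurable.mul (by fun_prop) (mJ.comp (f := fun p : (ℕ → ℝ) × Pattern K =>
          (σ, p.1, p.2)) (by fun_prop))
      have h := ih (fun p => interlaceInd K p.1 σ * J σ p.1 p.2) mS
      calc _ = ∫⁻ T : Pattern K, ind T * ∫⁻ c, interlaceInd K (top T) σ *
            J σ (top T) (insert φ T c) ∂columnLaw r K ∂vol K := by
            refine lintegral_congr fun T => ?_
            rw [e1, lintegral_const_mul]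
            · exact mul_assoc _ _ _
            exact mJ.comp (f := fun c : Column K => (σ, top T, insert φ T c))
              (measurable_const.prodMk (measurable_const.prodMk
                (mins.comp measurable_prodMk_left)))
        _ = _ := by
            rw [h]
            refine lintegral_congr fun T => ?_
            congr 1
            exact lintegral_insertLevel φ hr K σ (top T) (mG.comp (f := fun σ' : ℕ → ℝ =>
              (σ, T, σ')) (by fun_prop))
    rw [Tower.lintegral_measure_succ_symm _ K mLHS, Tower.lintegral_measure_succ _ K mRHS]
    refine (lintegral_congr step).trans ?_
    have mR2 : Measurable fun p : (ℕ → ℝ) × Pattern K =>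
        ind p.2 * ∫⁻ σ', R p.1 p.2 σ' ∂seqVol (K + 1) := by
      refine Measurable.mul (by fun_prop) (Measurable.lintegral_prod_right'
        (f := fun p : ((ℕ → ℝ) × Pattern K) × (ℕ → ℝ) => R p.1.1 p.1.2 p.2) ?_)
      exact mR.comp (f := fun p : ((ℕ → ℝ) × Pattern K) × (ℕ → ℝ) => (p.1.1, p.1.2, p.2))
        (by fun_prop)
    rw [lintegral_lintegral_swap mR2.aemeasurable]
    refine lintegral_congr fun T => ?_
    have mT : Measurable fun p : (ℕ → ℝ) × (ℕ → ℝ) => R p.1 T p.2 :=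
      mR.comp (f := fun p : (ℕ → ℝ) × (ℕ → ℝ) => (p.1, T, p.2)) (by fun_prop)
    rw [lintegral_const_mul _ mT.lintegral_prod_right',
      lintegral_lintegral_swap (f := fun σ σ' => R σ T σ') mT.aemeasurable,
      ← lintegral_const_mul _ mT.lintegral_prod_left']
    refine lintegral_congr fun σ' => ?_
    change _ = ind T * interlaceInd K (top T) σ' *
      ∫⁻ σ, stepDensity r (K + 1) σ σ' * G (σ, ((T, σ') : Pattern (K + 1))) ∂seqVol (K + 1)
    have mσ : Measurable fun σ : ℕ → ℝ =>
        stepDensity r (K + 1) σ σ' * G (σ, ((T, σ') : Pattern (K + 1))) :=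
      Measurable.mul (by fun_prop) (mG.comp (f := fun σ : ℕ → ℝ => (σ, T, σ')) (by fun_prop))
    rw [mul_assoc, ← lintegral_const_mul _ mσ]
    congr 1
    exact lintegral_congr fun σ => mul_left_comm _ _ _

end Pattern

end LPP

namespace LPP

open scoped ENNReal NNReal Classical Topology

/-! ### Inserting a staircase array -/

/-- Staircase arrays: one column of each height `1, …, K`. -/
abbrev Staircase (K : ℕ) : Type := Tower (fun k => Column (k + 1)) K

/-- The law of a staircase array of independent exponential weights. -/
noncomputable abbrev staircaseLaw (r : ℝ) (K : ℕ) : Measure (Staircase K) :=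
  Tower.measure (fun k => Pattern.columnLaw r (k + 1)) K

namespace Pattern

/-- Insert the columns of a staircase array, the highest first. After each insertion, note the
first entry of the last level and then drop this level. -/
noncomputable def record (φ : LocalRule) : ∀ {K : ℕ}, Pattern K → Staircase K → ℕ → ℝ
  | 0, _, _ => 0
  | K + 1, T, x => seqCons ((insert φ (K := K + 1) T x.2).2 0)
      (record φ (K := K) (insert φ (K := K + 1) T x.2).1 x.1)

theorem continuous_init {K : ℕ} : Continuous fun T : Pattern (K + 1) => (T.1 : Pattern K) :=
  continuous_fst (X := Pattern K) (Y := ℕ → ℝ)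

theorem continuous_record (φ : LocalRule) :
    ∀ {K : ℕ}, Continuous fun p : Pattern K × Staircase K => record φ p.1 p.2
  | 0 => continuous_const
  | K + 1 => by
    have e1 : Continuous fun p : Pattern (K + 1) × Staircase (K + 1) => (p.2.1 : Staircase K) :=
      (continuous_fst (X := Staircase K) (Y := Column (K + 1))).comp continuous_snd
    have e2 : Continuous fun p : Pattern (K + 1) × Staircase (K + 1) => (p.2.2 : Column (K + 1)) :=
      (continuous_snd (X := Staircase K) (Y := Column (K + 1))).comp continuous_snd
    have h : Continuous fun p : Pattern (K + 1) × Staircase (K + 1) =>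
        insert φ (K := K + 1) p.1 p.2.2 := (continuous_insert φ).comp (continuous_fst.prodMk e2)
    exact ((continuous_apply 0).comp (continuous_top.comp h)).seqCons
      ((continuous_record φ).comp ((continuous_init.comp h).prodMk e1))

/-- For a pattern that is uniform given its top level, the law of the record does not depend on
the local rule. -/
theorem lintegral_record (φ ψ : LocalRule) {r : ℝ} (hr : 0 < r) : ∀ (K : ℕ)
    (G F : (ℕ → ℝ) → ℝ≥0∞), Measurable G → Measurable F →
    ∫⁻ T, ind T * (G (top T) * ∫⁻ x, F (record φ T x) ∂staircaseLaw r K) ∂vol K =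
      ∫⁻ T, ind T * (G (top T) * ∫⁻ x, F (record ψ T x) ∂staircaseLaw r K) ∂vol K := by
  have := isProbabilityMeasure_expMeasure hr
  intro K
  induction K with
  | zero => intro G F _ _; rfl
  | succ K ih =>
    intro G F hG hF
    set G' : (ℕ → ℝ) → ℝ≥0∞ := fun σ' => ∫⁻ σ, stepDensity r (K + 1) σ σ' * G σ ∂seqVol (K + 1)
      with hG'
    have mG' : Measurable G' := Measurable.lintegral_prod_right' (f := fun p : (ℕ → ℝ) × (ℕ → ℝ) =>
      stepDensity r (K + 1) p.2 p.1 * G p.2) (by fun_prop)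
    have key : ∀ χ : LocalRule, ∫⁻ T : Pattern (K + 1), ind T * (G (top T) *
          ∫⁻ x, F (record χ T x) ∂staircaseLaw r (K + 1)) ∂vol (K + 1) =
        ∫⁻ σ', ∫⁻ T : Pattern K, ind T * (interlaceInd K (top T) σ' * G' σ' *
          ∫⁻ y, F (seqCons (σ' 0) (record χ T y)) ∂staircaseLaw r K) ∂vol K ∂seqVol (K + 1) := by
      intro χ
      have mrec : Measurable fun p : Pattern K × Staircase K => record χ p.1 p.2 :=
        (continuous_record χ).measurable
      have mcons : Measurable fun p : (Pattern K × (ℕ → ℝ)) × Staircase K =>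
          F (seqCons (p.1.2 0) (record χ p.1.1 p.2)) := by
        refine hF.comp (measurable_seqCons.comp
          (f := fun p : (Pattern K × (ℕ → ℝ)) × Staircase K =>
            (p.1.2 0, record χ p.1.1 p.2)) (Measurable.prodMk (by fun_prop) ?_))
        exact mrec.comp (f := fun p : (Pattern K × (ℕ → ℝ)) × Staircase K => (p.1.1, p.2))
          (by fun_prop)
      set H : Pattern (K + 1) → ℝ≥0∞ := fun T' =>
        ∫⁻ y, F (seqCons (T'.2 0) (record χ (K := K) T'.1 y)) ∂staircaseLaw r K with hH
      have mH : Measurable H := mcons.lintegral_prod_right'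
      have e1 : ∀ T : Pattern (K + 1), ∫⁻ x, F (record χ T x) ∂staircaseLaw r (K + 1) =
          ∫⁻ c, H (insert χ T c) ∂columnLaw r (K + 1) := by
        intro T
        rw [Tower.lintegral_measure_succ_symm]
        · rfl
        · exact hF.comp ((continuous_record χ).measurable.comp measurable_prodMk_left)
      have mGH : Measurable fun p : (ℕ → ℝ) × Pattern (K + 1) => G p.1 * H p.2 := by fun_prop
      have h := lintegral_insert χ hr (K + 1) (fun p => G p.1 * H p.2) mGH
      have e2 : ∀ T : Pattern (K + 1), G (top T) * ∫⁻ x, F (record χ T x) ∂staircaseLaw r (K + 1) =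
          ∫⁻ c, G (top T) * H (insert χ T c) ∂columnLaw r (K + 1) := by
        intro T
        rw [e1, lintegral_const_mul]
        exact mH.comp ((continuous_insert χ).measurable.comp measurable_prodMk_left)
      simp only [e2]
      rw [h]
      have e3 : ∀ T : Pattern (K + 1), ∫⁻ σ, stepDensity r (K + 1) σ (top T) * (G σ * H T)
          ∂seqVol (K + 1) = G' (top T) * H T := by
        intro T
        simp only [← mul_assoc]
        rw [lintegral_mul_const _ (by fun_prop)]
      simp only [e3]
      rw [Tower.lintegral_measure_succ_symm]
      · refine lintegral_congr fun σ' => lintegral_congr fun T => ?_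
        change ind T * interlaceInd K (top T) σ' * (G' σ' * _) = _
        simp only [hH, mul_assoc]
      · exact measurable_ind.mul ((mG'.comp continuous_top.measurable).mul mH)
    rw [key φ, key ψ]
    refine lintegral_congr fun σ' => ?_
    exact ih (fun κ => interlaceInd K κ σ' * G' σ') (fun s => F (seqCons (σ' 0) s))
      (by fun_prop) (hF.comp (measurable_seqCons.comp measurable_prodMk_left))

/-! ### Shrinking the initial pattern to zero -/

/-- The zero pattern. -/
def zero (K : ℕ) : Pattern K := Tower.ofSeq (fun _ => 0) K

/-- The patterns all of whose entries are at most `ε` in absolute value. -/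
def Small (ε : ℝ) : ∀ {K : ℕ}, Pattern K → Prop
  | 0, _ => True
  | K + 1, T => Small ε (K := K) T.1 ∧ ∀ l, |T.2 l| ≤ ε

theorem Small.mono {ε δ : ℝ} (h : ε ≤ δ) : ∀ {K : ℕ} {T : Pattern K}, Small ε T → Small δ T
  | 0, _, _ => trivial
  | _ + 1, _, hT => ⟨Small.mono h hT.1, fun l => (hT.2 l).trans h⟩

theorem exists_seq_small {U : Set (ℕ → ℝ)} (hU : U ∈ 𝓝 (0 : ℕ → ℝ)) :
    ∃ ε > 0, ∀ s : ℕ → ℝ, (∀ l, |s l| ≤ ε) → s ∈ U := by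
  rw [nhds_pi, Filter.mem_pi] at hU
  obtain ⟨I, hI, t, ht, hU⟩ := hU
  have h : ∀ᶠ ε in 𝓝[>] (0 : ℝ), ∀ i ∈ I, Metric.closedBall (0 : ℝ) ε ⊆ t i := by
    refine (Filter.eventually_all_finite hI).2 fun i _ => ?_
    obtain ⟨δ, hδ, hb⟩ := Metric.nhds_basis_closedBall.mem_iff.1 (ht i)
    filter_upwards [Ioo_mem_nhdsGT hδ] with ε hε
    exact (Metric.closedBall_subset_closedBall hε.2.le).trans hb
  obtain ⟨ε, hε, hpos⟩ := (h.and self_mem_nhdsWithin).exists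
  exact ⟨ε, hpos, fun s hs => hU fun i hi => hε i hi (by simpa using hs i)⟩

theorem exists_small : ∀ {K : ℕ} {U : Set (Pattern K)}, U ∈ 𝓝 (zero K) →
    ∃ ε > 0, ∀ T : Pattern K, Small ε T → T ∈ U
  | 0, U, hU => ⟨1, one_pos, fun T _ => mem_of_mem_nhds hU⟩
  | K + 1, U, hU => by
    obtain ⟨V, hV, W, hW, h⟩ := mem_nhds_prod_iff.1
      (show U ∈ 𝓝 ((zero K, 0) : Pattern K × _) from hU)
    obtain ⟨ε, hε, h1⟩ := exists_small hV
    obtain ⟨δ, hδ, h2⟩ := exists_seq_small hW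
    refine ⟨min ε δ, lt_min hε hδ, fun T hT => h ⟨h1 _ (hT.1.mono (min_le_left _ _)), ?_⟩⟩
    exact h2 _ fun l => (hT.2 l).trans (min_le_right _ _)

theorem ae_seqVol (m : ℕ) : ∀ᵐ s ∂seqVol m, ∀ l, m ≤ l → s l = 0 := by
  have hms : ∀ m, MeasurableSet {s : ℕ → ℝ | ∀ l, m ≤ l → s l = 0} := by
    intro m
    simp only [Set.ofPred_forall]
    exact .iInter fun l => .iInter fun _ => measurableSet_eq_fun (by fun_prop) (by fun_prop)
  induction m with
  | zero => rw [seqVol]; exact (ae_dirac_iff (hms 0)).2 fun l _ => rfl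
  | succ m ih =>
    rw [seqVol, ae_map_iff measurable_seqCons.aemeasurable (hms (m + 1))]
    filter_upwards [Measure.quasiMeasurePreserving_snd.ae ih] with p hp l hl
    obtain ⟨l, rfl⟩ : ∃ k, l = k + 1 := ⟨l - 1, by omega⟩
    exact hp l (by omega)

/-- Almost every Gelfand–Tsetlin pattern is controlled by its last level. -/
theorem ae_small (ε : ℝ) (hε : 0 ≤ ε) : ∀ K : ℕ, ∀ᵐ T ∂vol K,
    ind T ≠ 0 → top T ∈ box K (fun _ => 0) (fun _ => ε) → Small ε T
  | 0 => Filter.Eventually.of_forall fun _ _ _ => trivial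
  | K + 1 => by
    have h1 : ∀ᵐ T ∂((vol K).prod (seqVol (K + 1))), ind T.1 ≠ 0 →
        top T.1 ∈ box K (fun _ => 0) (fun _ => ε) → Small ε T.1 :=
      Measure.quasiMeasurePreserving_fst.ae (ae_small ε hε K)
    have h2 : ∀ᵐ T ∂((vol K).prod (seqVol (K + 1))), ∀ l, K + 1 ≤ l → T.2 l = 0 :=
      Measure.quasiMeasurePreserving_snd.ae (ae_seqVol (K + 1))
    change ∀ᵐ T ∂((vol K).prod (seqVol (K + 1))), _
    filter_upwards [h1, h2] with T hT1 hT2 hi hb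
    have hi' : ind (K := K) T.1 * interlaceInd K (top (K := K) T.1) T.2 ≠ 0 := hi
    have hb' : ∀ l < K + 1, 0 ≤ T.2 l ∧ T.2 l ≤ ε := hb
    have hint : Interlaces K (top (K := K) T.1) T.2 := by
      by_contra hcon
      exact right_ne_zero_of_mul hi' (by rw [interlaceInd, if_neg hcon])
    refine ⟨hT1 (left_ne_zero_of_mul hi') fun l hl => ?_, fun l => ?_⟩
    · exact ⟨(hb' (l + 1) (by omega)).1.trans (hint l hl).1,
        (hint l hl).2.trans (hb' l (by omega)).2⟩
    · by_cases hl : l < K + 1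
      · rw [abs_of_nonneg (hb' l hl).1]; exact (hb' l hl).2
      · rw [hT2 l (by omega), abs_zero]; exact hε

theorem seqVol_box_succ (m : ℕ) (a b : ℕ → ℝ) : seqVol (m + 1) (box (m + 1) a b) =
    ENNReal.ofReal (b 0 - a 0) * seqVol m (box m (seqTail a) (seqTail b)) := by
  have h := setLIntegral_box_succ m a b (f := fun _ => 1) measurable_const
  simpa [mul_comm] using h

theorem seqVol_box_lt_top (m : ℕ) : ∀ a b : ℕ → ℝ, seqVol m (box m a b) < ∞ := by
  induction m with
  | zero => intro a b; rw [seqVol]; exact measure_lt_top _ _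
  | succ m ih =>
    intro a b
    rw [seqVol_box_succ]
    exact ENNReal.mul_lt_top ENNReal.ofReal_lt_top (ih _ _)

theorem seqVol_box_pos (m : ℕ) : ∀ {a b : ℕ → ℝ}, (∀ l, a l < b l) →
    0 < seqVol m (box m a b) := by
  induction m with
  | zero =>
    intro a b _
    have hb : box 0 a b = Set.univ := by ext; simp [box]
    simp [hb, seqVol]
  | succ m ih =>
    intro a b h
    rw [seqVol_box_succ]
    exact ENNReal.mul_pos (by simpa using h 0) (ih fun l => h (l + 1)).ne'

/-- The mass of the Gelfand–Tsetlin patterns with last level in a box. -/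
noncomputable def boxMass (K : ℕ) (a b : ℕ → ℝ) : ℝ≥0∞ :=
  ∫⁻ T, ind T * (box K a b).indicator 1 (top T) ∂vol K

theorem measurable_boxInd (K : ℕ) (a b : ℕ → ℝ) :
    Measurable ((box K a b).indicator (1 : (ℕ → ℝ) → ℝ≥0∞)) :=
  measurable_one.indicator (measurableSet_box K a b)

theorem boxMass_succ (K : ℕ) (a b : ℕ → ℝ) : boxMass (K + 1) a b =
    ∫⁻ σ in box (K + 1) a b, (∫⁻ T : Pattern K, ind T * interlaceInd K (top T) σ ∂vol K)
      ∂seqVol (K + 1) := by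
  rw [boxMass, Tower.lintegral_measure_succ_symm, ← lintegral_indicator (measurableSet_box _ _ _)]
  · refine lintegral_congr fun σ => ?_
    change ∫⁻ T : Pattern K, ind T * interlaceInd K (top T) σ *
      (box (K + 1) a b).indicator 1 σ ∂vol K = _
    by_cases h : σ ∈ box (K + 1) a b <;> simp [h]
  · exact measurable_ind.mul ((measurable_boxInd _ _ _).comp continuous_top.measurable)

theorem boxMass_lt_top (ε : ℝ) : ∀ K : ℕ, boxMass K (fun _ => 0) (fun _ => ε) < ∞
  | 0 => by
    rw [boxMass, Tower.lintegral_measure_zero]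
    simp [ind, box]
  | K + 1 => by
    rw [boxMass_succ]
    refine lt_of_le_of_lt (setLIntegral_mono measurable_const fun σ hσ => ?_)
      (b := ∫⁻ _ in box (K + 1) (fun _ => 0) (fun _ => ε), boxMass K (fun _ => 0) (fun _ => ε)
        ∂seqVol (K + 1)) ?_
    · refine lintegral_mono fun T => mul_le_mul_right ?_ _
      by_cases h : Interlaces K (top T) σ
      · rw [Set.indicator_of_mem, interlaceInd, if_pos h]
        · rfl
        · exact fun l hl => ⟨(hσ (l + 1) (by omega)).1.trans (h l hl).1,
            (h l hl).2.trans (hσ l (by omega)).2⟩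
      · rw [interlaceInd, if_neg h]; exact zero_le
    · rw [setLIntegral_const]
      exact ENNReal.mul_lt_top (boxMass_lt_top ε K) (seqVol_box_lt_top _ _ _)

theorem boxMass_pos : ∀ (K : ℕ) {a b : ℕ → ℝ}, (∀ l, a l < b l) → (∀ l, b (l + 1) < a l) →
    0 < boxMass K a b
  | 0, a, b, _, _ => by
    rw [boxMass, Tower.lintegral_measure_zero]
    simp [ind, box]
  | K + 1, a, b, h1, h2 => by
    -- the middle thirds of the gaps between the given intervals
    set a' : ℕ → ℝ := fun l => (2 * b (l + 1) + a l) / 3 with ha'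
    set b' : ℕ → ℝ := fun l => (b (l + 1) + 2 * a l) / 3 with hb'
    have ih : 0 < boxMass K a' b' := by
      refine boxMass_pos K (fun l => ?_) fun l => ?_
      · have := h2 l; simp only [ha', hb']; linarith
      · have := h2 l; have := h1 (l + 1); have := h2 (l + 1); simp only [ha', hb']; linarith
    rw [boxMass_succ]
    refine lt_of_lt_of_le (b := ∫⁻ _ in box (K + 1) a b, boxMass K a' b' ∂seqVol (K + 1)) ?_
      (setLIntegral_mono' (measurableSet_box _ _ _) fun σ hσ => ?_)
    · rw [setLIntegral_const]
      exact ENNReal.mul_pos ih.ne' (seqVol_box_pos _ h1).ne'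
    · refine lintegral_mono fun T => mul_le_mul_right ?_ _
      by_cases h : top T ∈ box K a' b'
      · rw [Set.indicator_of_mem h, interlaceInd, if_pos]
        · rfl
        · intro l hl
          have e1 := (hσ (l + 1) (by omega)).2
          have e2 := (hσ l (by omega)).1
          have e3 := h l hl
          have e4 := h2 l
          simp only [ha', hb'] at e3
          exact ⟨by linarith, by linarith⟩
      · rw [Set.indicator_of_notMem h]; exact zero_le

/-- Continuous functions with the same integrals over the Gelfand–Tsetlin patterns with prescribed
last level agree at the zero pattern. -/
theorem le_of_lintegral_eq {K : ℕ} {f g : Pattern K → ℝ≥0∞} (hf : Continuous f)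
    (hg : Continuous g) (h : ∀ G : (ℕ → ℝ) → ℝ≥0∞, Measurable G →
      ∫⁻ T, ind T * (G (top T) * f T) ∂vol K = ∫⁻ T, ind T * (G (top T) * g T) ∂vol K) :
    g (zero K) ≤ f (zero K) := by
  by_contra! hlt
  obtain ⟨p, hp1, hp2⟩ := exists_between hlt
  obtain ⟨q, hq1, hq2⟩ := exists_between hp2
  obtain ⟨ε, hε, hs⟩ := exists_small (K := K) (U := {T | f T < p ∧ q < g T})
    ((hf.continuousAt.eventually_lt continuousAt_const hp1).and
      (continuousAt_const.eventually_lt hg.continuousAt hq2))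
  set w : (ℕ → ℝ) → ℝ≥0∞ := (box K (fun _ => 0) (fun _ => ε)).indicator 1 with hw
  have mw : Measurable w := measurable_boxInd _ _ _
  have hae : ∀ᵐ T ∂vol K, ind T * w (top T) ≠ 0 → f T < p ∧ q < g T := by
    filter_upwards [ae_small ε hε.le K] with T hT h0
    refine hs T (hT (left_ne_zero_of_mul h0) ?_)
    by_contra hb
    exact right_ne_zero_of_mul h0 (Set.indicator_of_notMem hb _)
  set M := boxMass K (fun _ => 0) (fun _ => ε) with hM
  have mM : Measurable fun T : Pattern K => ind T * w (top T) :=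
    measurable_ind.mul (mw.comp continuous_top.measurable)
  have h1 : ∫⁻ T, ind T * (w (top T) * f T) ∂vol K ≤ M * p := by
    rw [hM, boxMass, ← lintegral_mul_const _ mM]
    refine lintegral_mono_ae ?_
    filter_upwards [hae] with T hT
    rw [← mul_assoc]
    by_cases h0 : ind T * w (top T) = 0
    · simp [h0]
    · exact mul_le_mul_right (hT h0).1.le _
  have h2 : M * q ≤ ∫⁻ T, ind T * (w (top T) * g T) ∂vol K := by
    rw [hM, boxMass, ← lintegral_mul_const _ mM]
    refine lintegral_mono_ae ?_
    filter_upwards [hae] with T hT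
    rw [← mul_assoc]
    by_cases h0 : ind T * w (top T) = 0
    · simp [hw] at h0 ⊢
      rcases h0 with h0 | h0 <;> simp [h0]
    · exact mul_le_mul_right (hT h0).2.le _
  have hpos : 0 < M := by
    refine lt_of_lt_of_le (boxMass_pos K (a := fun l => ε / (2 * l + 3))
      (b := fun l => ε / (2 * l + 2)) (fun l => ?_) fun l => ?_) ?_
    · exact div_lt_div_of_pos_left hε (by positivity) (by linarith)
    · push_cast
      exact div_lt_div_of_pos_left hε (by positivity) (by linarith)
    · refine lintegral_mono fun T => mul_le_mul_right ?_ _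
      refine Set.indicator_le_indicator_of_subset (fun s hs l hl => ?_) (fun _ => zero_le) _
      have hs' := hs l hl
      simp only at hs'
      refine ⟨le_trans (by positivity) hs'.1, hs'.2.trans ?_⟩
      exact div_le_self hε.le (by linarith [(Nat.cast_nonneg l : (0 : ℝ) ≤ l)])
  have hle : M * q ≤ M * p := h2.trans ((h w mw).ge.trans h1)
  have hMt : M ≠ ∞ := (boxMass_lt_top ε K).ne
  exact absurd ((ENNReal.mul_le_mul_iff_right hpos.ne' hMt).1 hle) (not_le.2 hq1)

/-- `lintegral_record` for the zero pattern: the expectation of a bounded continuous function of the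
record is continuous in the initial pattern, so `le_of_lintegral_eq` applies. -/
theorem lintegral_record_zero (φ ψ : LocalRule) {r : ℝ} (hr : 0 < r) (K : ℕ)
    {F : (ℕ → ℝ) → ℝ≥0} (hF : Continuous F) {C : ℝ≥0} (hC : ∀ s, F s ≤ C) :
    ∫⁻ x, F (record φ (zero K) x) ∂staircaseLaw r K =
      ∫⁻ x, F (record ψ (zero K) x) ∂staircaseLaw r K := by
  have := isProbabilityMeasure_expMeasure hr
  have hcont : ∀ χ : LocalRule, Continuous fun T : Pattern K =>
      ∫⁻ x, (F (record χ T x) : ℝ≥0∞) ∂staircaseLaw r K := by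
    intro χ
    refine continuous_iff_continuousAt.2 fun T => ?_
    refine tendsto_lintegral_filter_of_dominated_convergence (fun _ => (C : ℝ≥0∞))
      (Filter.Eventually.of_forall fun T' => ?_)
      (Filter.Eventually.of_forall fun T' => Filter.Eventually.of_forall fun x => ?_) ?_
      (Filter.Eventually.of_forall fun x => ?_)
    · have := (continuous_record χ (K := K)).comp (Continuous.prodMk_right T')
      exact (ENNReal.continuous_coe.comp (hF.comp this)).measurable
    · exact ENNReal.coe_le_coe.2 (hC _)
    · simp
    · have := (continuous_record χ (K := K)).comp (Continuous.prodMk_left x)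
      exact (ENNReal.continuous_coe.comp (hF.comp this)).continuousAt
  have hm : Measurable fun s => (F s : ℝ≥0∞) := (ENNReal.continuous_coe.comp hF).measurable
  exact le_antisymm
    (le_of_lintegral_eq (hcont ψ) (hcont φ) fun G hG => lintegral_record ψ φ hr K G _ hG hm)
    (le_of_lintegral_eq (hcont φ) (hcont ψ) fun G hG => lintegral_record φ ψ hr K G _ hG hm)

end Pattern

end LPP

namespace LPP

/-! ### Passage times through a sequence of columns -/

/-- Passage times after a column of weights `c`, when its row `i` is entered at time `h i`:
the largest of `h i + c i + ⋯ + c k` over `i ≤ k`. -/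
noncomputable def passage (c h : ℕ → ℝ) : ℕ → ℝ
  | 0 => h 0 + c 0
  | k + 1 => max (h (k + 1)) (passage c h k) + c (k + 1)

/-- Passage through the columns `w 0, …, w (M - 1)` in this order. -/
noncomputable def passageFwd (w : ℕ → ℕ → ℝ) : ℕ → (ℕ → ℝ) → ℕ → ℝ
  | 0, h => h
  | M + 1, h => passage (w M) (passageFwd w M h)

/-- Passage through the columns `w (M - 1), …, w 0` in this order. -/
noncomputable def passageBwd (w : ℕ → ℕ → ℝ) : ℕ → (ℕ → ℝ) → ℕ → ℝ
  | 0, h => h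
  | M + 1, h => passageBwd w M (passage (w M) h)

theorem passage_congr {c c' h h' : ℕ → ℝ} {M : ℕ} (hc : ∀ k < M, c k = c' k)
    (hh : ∀ k < M, h k = h' k) : ∀ k < M, passage c h k = passage c' h' k := by
  intro k
  induction k with
  | zero => intro hk; simp only [passage, hc 0 hk, hh 0 hk]
  | succ k ih =>
    intro hk
    simp only [passage, hc _ hk, hh _ hk, ih (by omega)]

theorem passageFwd_congr {w w' : ℕ → ℕ → ℝ} : ∀ {M : ℕ} {h : ℕ → ℝ}, (∀ i < M, w i = w' i) →
    passageFwd w M h = passageFwd w' M h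
  | 0, _, _ => rfl
  | M + 1, h, hw => by
    rw [passageFwd, passageFwd, hw M (by omega), passageFwd_congr fun i hi => hw i (by omega)]

theorem passageBwd_congr (w : ℕ → ℕ → ℝ) {N : ℕ} : ∀ (M : ℕ) {h h' : ℕ → ℝ},
    (∀ k < N, h k = h' k) → ∀ k < N, passageBwd w M h k = passageBwd w M h' k
  | 0, _, _, hh => hh
  | M + 1, _, _, hh => passageBwd_congr w M (passage_congr (fun _ _ => rfl) hh)

theorem passageBwd_succ (w : ℕ → ℕ → ℝ) : ∀ (M : ℕ) (h : ℕ → ℝ),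
    passageBwd w (M + 1) h = passage (w 0) (passageBwd (fun l => w (l + 1)) M h)
  | 0, _ => rfl
  | M + 1, h => by rw [passageBwd, passageBwd_succ w M, passageBwd]

theorem passageBwd_eq_passageFwd : ∀ (M : ℕ) (w : ℕ → ℕ → ℝ) (h : ℕ → ℝ),
    passageBwd w M h = passageFwd (fun i => w (M - 1 - i)) M h
  | 0, _, _ => rfl
  | M + 1, w, h => by
    rw [passageBwd_succ, passageBwd_eq_passageFwd M, passageFwd]
    have h0 : M + 1 - 1 - M = 0 := by omega
    rw [h0]
    congr 1
    refine passageFwd_congr fun i hi => ?_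
    rw [show M - 1 - i + 1 = M + 1 - 1 - i by omega]

theorem passage_mono {c h : ℕ → ℝ} (hc : ∀ k, 0 ≤ c k) : Monotone (passage c h) := by
  refine monotone_nat_of_le_succ fun k => ?_
  have h1 := le_max_right (h (k + 1)) (passage c h k)
  have h2 := hc (k + 1)
  simp only [passage]
  linarith

/-- A column of zeros has no effect on nondecreasing entrance times. -/
theorem passage_of_eq_zero {c h : ℕ → ℝ} {M : ℕ} (hc : ∀ k < M, c k = 0) (hh : Monotone h) :
    ∀ k < M, passage c h k = h k := by
  intro k
  induction k with
  | zero => intro hk; simp [passage, hc 0 hk]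
  | succ k ih =>
    intro hk
    rw [passage, ih (by omega), hc _ hk, add_zero, max_eq_left (hh (Nat.le_succ k))]

/-- Two columns `f`, `g` may be replaced by `g'`, `f'` without changing any passage time. Here
`D` is the queue length, `g'` the part of `f` that the queue absorbs, and `f'` the remainder. -/
theorem passage_exchange {f g f' g' D : ℕ → ℝ} (hg' : ∀ k, g' k = min (f k) (D k))
    (hf' : ∀ k, f' k = f k + g k - g' k) (hD : ∀ k, D (k + 1) = D k + g k - g' k)
    (h : ℕ → ℝ) : passage g (passage f h) = passage f' (passage g' h) := by
  have key : ∀ k, passage g (passage f h) k = passage f' (passage g' h) k ∧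
      max (passage g (passage f h) k - D (k + 1)) (passage g' h k) = passage f h k := by
    intro k
    induction k with
    | zero =>
      simp only [passage, hf', hD, hg']
      refine ⟨by ring, ?_⟩
      rcases min_cases (f 0) (D 0) with ⟨h1, h2⟩ | ⟨h1, h2⟩ <;> rw [h1]
      · exact max_eq_right (by linarith)
      · exact (max_eq_left (by linarith)).trans (by ring)
    | succ k ih =>
      obtain ⟨ih1, ih2⟩ := ih
      simp only [passage, hf' (k + 1), hD (k + 1), hg' (k + 1)]
      rw [← ih1, ← ih2]
      generalize passage g (passage f h) k = v
      generalize passage g' h k = u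
      generalize h (k + 1) = y
      generalize D (k + 1) = d
      generalize f (k + 1) = p
      generalize g (k + 1) = q
      constructor <;> grind
  exact funext fun k => (key k).1

/-! ### Insertion into infinite patterns -/

/-- The level below level `k` of an infinite pattern. -/
def prevLevel (T : ℕ → ℕ → ℝ) : ℕ → ℕ → ℝ
  | 0 => 0
  | k + 1 => T k

/-- Insertion of a column of weights into an infinite pattern, level by level. -/
noncomputable def insertSeq (φ : LocalRule) (T : ℕ → ℕ → ℝ) (c : ℕ → ℝ) : ℕ → ℕ → ℝ
  | 0 => insertLevel φ 0 0 (T 0) 0 (c 0)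
  | k + 1 => insertLevel φ (k + 1) (T k) (T (k + 1)) (insertSeq φ T c k) (c (k + 1))

theorem insertSeq_eq (φ : LocalRule) (T : ℕ → ℕ → ℝ) (c : ℕ → ℝ) : ∀ k, insertSeq φ T c k =
    insertLevel φ k (prevLevel T k) (T k) (prevLevel (insertSeq φ T c) k) (c k)
  | 0 => rfl
  | _ + 1 => rfl

/-- The pattern obtained from zero by inserting the columns `x 0, …, x (a - 1)`. -/
noncomputable def growth (φ : LocalRule) (x : ℕ → ℕ → ℝ) : ℕ → ℕ → ℕ → ℝ
  | 0 => 0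
  | a + 1 => insertSeq φ (growth φ x a) (x a)

namespace Pattern

theorem top_ofSeq (T : ℕ → ℕ → ℝ) : ∀ K, top (Tower.ofSeq T K : Pattern K) = prevLevel T K
  | 0 => rfl
  | _ + 1 => rfl

theorem insert_ofSeq (φ : LocalRule) (T : ℕ → ℕ → ℝ) (c : ℕ → ℝ) : ∀ K,
    insert φ (Tower.ofSeq T K : Pattern K) (Tower.ofSeq c K) = Tower.ofSeq (insertSeq φ T c) K
  | 0 => rfl
  | K + 1 => by
    have ih := insert_ofSeq φ T c K
    change (insert φ (Tower.ofSeq T K : Pattern K) (Tower.ofSeq c K),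
      insertLevel φ K (top (Tower.ofSeq T K : Pattern K)) (T K)
        (top (insert φ (Tower.ofSeq T K : Pattern K) (Tower.ofSeq c K))) (c K)) =
      ((Tower.ofSeq (insertSeq φ T c) K, insertSeq φ T c K) : Pattern K × (ℕ → ℝ))
    rw [ih, top_ofSeq, top_ofSeq, ← insertSeq_eq]

/-- The staircase part, with columns of heights `N, N - 1, …` from left to right, of an infinite
array. -/
def staircase (N : ℕ) (x : ℕ → ℕ → ℝ) (K : ℕ) : Staircase K :=
  Tower.ofSeq (fun k => (Tower.ofSeq (x (N - 1 - k)) (k + 1) : Column (k + 1))) K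

theorem record_staircase (φ : LocalRule) (N : ℕ) (x : ℕ → ℕ → ℝ) : ∀ (K s : ℕ), s + K = N →
    ∀ j < K, record φ (Tower.ofSeq (growth φ x s) K : Pattern K) (staircase N x K) j =
      growth φ x (s + j + 1) (K - 1 - j) 0
  | 0, _, _, j, hj => absurd hj (by omega)
  | K + 1, s, hs, j, hj => by
    have h : insert φ (Tower.ofSeq (growth φ x s) (K + 1) : Pattern (K + 1))
        (Tower.ofSeq (x (N - 1 - K)) (K + 1)) = Tower.ofSeq (growth φ x (s + 1)) (K + 1) := by
      rw [insert_ofSeq, show N - 1 - K = s by omega]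
      rfl
    change seqCons ((insert φ (Tower.ofSeq (growth φ x s) (K + 1) : Pattern (K + 1))
      (Tower.ofSeq (x (N - 1 - K)) (K + 1))).2 0) (record φ (K := K) (insert φ
        (Tower.ofSeq (growth φ x s) (K + 1) : Pattern (K + 1))
        (Tower.ofSeq (x (N - 1 - K)) (K + 1))).1 (staircase N x K)) j = _
    rw [h]
    cases j with
    | zero => rfl
    | succ j =>
      refine (record_staircase φ N x K (s + 1) (by omega) j (by omega)).trans ?_
      rw [show s + 1 + j + 1 = s + (j + 1) + 1 by omega,
        show K - 1 - j = K + 1 - 1 - (j + 1) by omega]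

end Pattern

/-! ### First entries under the Robinson–Schensted–Knuth rule -/

theorem carryOut_rskRule (m : ℕ) : ∀ (a b κ : ℕ → ℝ) (c : ℝ), carryOut rskRule m a b κ c = c := by
  induction m with
  | zero => intros; rfl
  | succ m ih => intro a b κ c; rw [carryOut, ih]; simp only [rskRule]; ring

theorem growth_rskRule (x : ℕ → ℕ → ℝ) : ∀ a : ℕ,
    (fun k => growth rskRule x a k 0) = passageFwd x a 0
  | 0 => rfl
  | a + 1 => by
    rw [passageFwd, ← growth_rskRule x a]
    funext k
    induction k with
    | zero => simp [growth, insertSeq, insertLevel, carryOut_rskRule, passage, lowerEnds]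
    | succ k ih =>
      rw [passage, ← ih]
      simp [growth, insertSeq, insertLevel, carryOut_rskRule, lowerEnds]

/-! ### First entries under the Burge rule -/

/-- The carry on arrival at the entry `l`, after the entries `m - 1, …, l`. -/
def carryAt (φ : LocalRule) (m : ℕ) (a b κ : ℕ → ℝ) (c : ℝ) (l : ℕ) : ℝ :=
  carryOut φ (m - l) (fun i => a (l + i)) (fun i => b (l + i)) (fun i => κ (l + i)) c

theorem carryAt_self (φ : LocalRule) (m : ℕ) (a b κ : ℕ → ℝ) (c : ℝ) :
    carryAt φ m a b κ c m = c := by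
  rw [carryAt, Nat.sub_self, carryOut]

theorem carryAt_zero (φ : LocalRule) (m : ℕ) (a b κ : ℕ → ℝ) (c : ℝ) :
    carryAt φ m a b κ c 0 = carryOut φ m a b κ c := by
  simp [carryAt]

theorem carryAt_eq (φ : LocalRule) {m l : ℕ} (hl : l < m) (a b κ : ℕ → ℝ) (c : ℝ) :
    carryAt φ m a b κ c l = a l + b l - κ l + carryAt φ m a b κ c (l + 1) -
      φ.out (a l) (b l) (κ l) (carryAt φ m a b κ c (l + 1)) := by
  have hs : ∀ s : ℕ → ℝ, seqTail (fun i => s (l + i)) = fun i => s (l + 1 + i) := fun s => by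
    funext i; simp only [seqTail_apply]; congr 1; omega
  rw [carryAt, carryAt, show m - l = m - (l + 1) + 1 by omega, carryOut]
  simp only [hs, add_zero]

theorem entriesOut_eq (φ : LocalRule) (l : ℕ) : ∀ {m : ℕ}, l < m → ∀ (a b κ : ℕ → ℝ) (c : ℝ),
    entriesOut φ m a b κ c l = φ.out (a l) (b l) (κ l) (carryAt φ m a b κ c (l + 1)) := by
  have hs : ∀ (l : ℕ) (s : ℕ → ℝ), (fun i => seqTail s (l + i)) = fun i => s (l + 1 + i) :=
    fun l s => by funext i; simp only [seqTail_apply]; congr 1; omega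
  have hc : ∀ (l m : ℕ) (a b κ : ℕ → ℝ) (c : ℝ), carryAt φ m (seqTail a) (seqTail b) (seqTail κ) c l
      = carryAt φ (m + 1) a b κ c (l + 1) := by
    intro l m a b κ c
    simp only [carryAt, hs]
    rw [Nat.add_sub_add_right]
  induction l with
  | zero =>
    intro m hm a b κ c
    obtain ⟨m, rfl⟩ : ∃ k, m = k + 1 := ⟨m - 1, by omega⟩
    rw [entriesOut, seqCons_zero, ← hc, carryAt_zero]
  | succ l ih =>
    intro m hm a b κ c
    obtain ⟨m, rfl⟩ : ∃ k, m = k + 1 := ⟨m - 1, by omega⟩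
    rw [entriesOut, seqCons_succ, ih (by omega), hc]
    rfl

/-- The infinite patterns with consecutive levels interlacing, level `k` having `k + 1` entries. -/
structure IsPattern (T : ℕ → ℕ → ℝ) : Prop where
  interlaces : ∀ k, Interlaces k (prevLevel T k) (T k)
  eq_zero : ∀ k l, k < l → T k l = 0

theorem insertSeq_eq_zero (φ : LocalRule) (T : ℕ → ℕ → ℝ) (c : ℕ → ℝ) {k l : ℕ} (h : k < l) :
    insertSeq φ T c k l = 0 := by
  obtain ⟨l, rfl⟩ : ∃ i, l = i + 1 := ⟨l - 1, by omega⟩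
  rw [insertSeq_eq]
  exact entriesOut_of_le φ k (by omega)

theorem prevLevel_eq_zero {T : ℕ → ℕ → ℝ} (h : ∀ k l, k < l → T k l = 0) :
    ∀ {k l : ℕ}, k ≤ l → prevLevel T k l = 0
  | 0, _, _ => rfl
  | k + 1, l, hl => h k l (by omega)

theorem IsPattern.insertSeq (φ : LocalRule) {T : ℕ → ℕ → ℝ} (hT : IsPattern T) {c : ℕ → ℝ}
    (hc : ∀ k, 0 ≤ c k) : IsPattern (insertSeq φ T c) := by
  refine ⟨fun k => ?_, fun k l h => insertSeq_eq_zero φ T c h⟩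
  have key : StripBelow k (prevLevel T k) (prevLevel (LPP.insertSeq φ T c) k) ∧
      (StripBelow k (prevLevel T k) (prevLevel (LPP.insertSeq φ T c) k) →
        StripBelow (k + 1) (T k) (LPP.insertSeq φ T c k) ∧
        Interlaces k (prevLevel (LPP.insertSeq φ T c) k) (LPP.insertSeq φ T c k)) := by
    induction k with
    | zero =>
      refine ⟨fun l hl => absurd hl (by omega), fun h => ?_⟩
      rw [insertSeq_eq]
      exact insertLevel_spec φ (hc _) (hT.interlaces 0) h
    | succ k ih =>
      refine ⟨(ih.2 ih.1).1, fun h => ?_⟩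
      rw [insertSeq_eq φ T c (k + 1)]
      exact insertLevel_spec φ (hc _) (hT.interlaces (k + 1)) h
  exact (key.2 key.1).2

theorem isPattern_growth (φ : LocalRule) {x : ℕ → ℕ → ℝ} (hx : ∀ a k, 0 ≤ x a k) :
    ∀ a, IsPattern (growth φ x a)
  | 0 => by
    refine ⟨fun k l _ => ?_, fun _ _ _ => rfl⟩
    cases k <;> exact ⟨le_rfl, le_rfl⟩
  | a + 1 => (isPattern_growth φ hx a).insertSeq φ (hx a)

/-- The `l`-th line of a pattern: the increments of the `l`-th entry from level to level. -/
def line (T : ℕ → ℕ → ℝ) (l k : ℕ) : ℝ := T k l - prevLevel T k l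

/-- As the lines of a pattern are ordered, the passage times through them are the entries of the
first line. -/
theorem passageBwd_line {T : ℕ → ℕ → ℝ} (hT : IsPattern T) {M k : ℕ} (hk : k < M) :
    passageBwd (line T) M 0 k = T k 0 := by
  have step : ∀ l, passage (line T l) (fun k => T k (l + 1)) = fun k => T k l := by
    intro l
    funext k
    induction k with
    | zero => simp [passage, line, prevLevel, hT.eq_zero 0 (l + 1) (by omega)]
    | succ k ih =>
      have hle : T (k + 1) (l + 1) ≤ T k l := by
        by_cases h : l < k + 1
        · exact (hT.interlaces (k + 1) l h).1
        · rw [hT.eq_zero _ _ (show k < l by omega), hT.eq_zero _ _ (show k + 1 < l + 1 by omega)]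
      rw [passage, ih, max_eq_right hle, line, prevLevel]
      ring
  have all : ∀ M, passageBwd (line T) M (fun k => T k M) = fun k => T k 0 := by
    intro M
    induction M with
    | zero => rfl
    | succ M ih => rw [passageBwd, step, ih]
  rw [← congrFun (all M) k]
  exact passageBwd_congr _ M (fun k hk => (hT.eq_zero k M hk).symm) k hk

/-- The carry of the Burge rule, as a column that travels through the lines of the pattern:
`burgeColumn T c l` has passed the lines with index at least `l`. -/
noncomputable def burgeColumn (T : ℕ → ℕ → ℝ) (c : ℕ → ℝ) (l k : ℕ) : ℝ :=
  if l ≤ k then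
    lowerEnds k (T k) (prevLevel (insertSeq burgeRule T c) k) l -
      prevLevel (insertSeq burgeRule T c) k l +
      carryAt burgeRule k (seqTail (lowerEnds k (T k) (prevLevel (insertSeq burgeRule T c) k)))
        (upperEnds (T k) (prevLevel (insertSeq burgeRule T c) k)) (prevLevel T k) (c k) l
  else c k

theorem burgeColumn_zero (T : ℕ → ℕ → ℝ) (c : ℕ → ℝ) :
    burgeColumn T c 0 = line (insertSeq burgeRule T c) 0 := by
  funext k
  rw [burgeColumn, if_pos (Nat.zero_le k), carryAt_zero, line, insertSeq_eq burgeRule T c k,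
    insertLevel, seqCons_zero]
  ring

/-- The Burge rule exchanges the travelling column with the lines of the pattern. -/
theorem burgeColumn_spec {T : ℕ → ℕ → ℝ} (hT : IsPattern T) {c : ℕ → ℝ} (hc : ∀ k, 0 ≤ c k)
    (l k : ℕ) :
    line (insertSeq burgeRule T c) (l + 1) k = min (burgeColumn T c (l + 1) k)
        (prevLevel T k l - prevLevel (insertSeq burgeRule T c) k (l + 1)) ∧
      burgeColumn T c l k = burgeColumn T c (l + 1) k + line T l k -
        line (insertSeq burgeRule T c) (l + 1) k := by
  have hz : ∀ k l, k < l → insertSeq burgeRule T c k l = 0 :=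
    fun k l h => insertSeq_eq_zero burgeRule T c h
  by_cases hl : l < k
  · have hl' : l + 1 ≤ k := hl
    have hout := entriesOut_eq burgeRule l hl
      (seqTail (lowerEnds k (T k) (prevLevel (insertSeq burgeRule T c) k)))
      (upperEnds (T k) (prevLevel (insertSeq burgeRule T c) k)) (prevLevel T k) (c k)
    have hT' : insertSeq burgeRule T c k (l + 1) = entriesOut burgeRule k
        (seqTail (lowerEnds k (T k) (prevLevel (insertSeq burgeRule T c) k)))
        (upperEnds (T k) (prevLevel (insertSeq burgeRule T c) k)) (prevLevel T k) (c k) l := by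
      rw [insertSeq_eq burgeRule T c k]; rfl
    have hcarry := carryAt_eq burgeRule hl
      (seqTail (lowerEnds k (T k) (prevLevel (insertSeq burgeRule T c) k)))
      (upperEnds (T k) (prevLevel (insertSeq burgeRule T c) k)) (prevLevel T k) (c k)
    rw [← hout, ← hT'] at hcarry
    rw [← hT'] at hout
    have hmm : lowerEnds k (T k) (prevLevel (insertSeq burgeRule T c) k) l +
        upperEnds (T k) (prevLevel (insertSeq burgeRule T c) k) l =
        T k l + prevLevel (insertSeq burgeRule T c) k l := by
      rw [lowerEnds, if_pos hl, upperEnds, max_add_min]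
    simp only [burgeColumn, if_pos hl', if_pos hl.le, line]
    simp only [seqTail_apply] at hcarry hout
    constructor
    · rw [hout, burgeRule, ← min_sub_sub_right]
      congr 1
      ring
    · rw [hcarry]
      linarith
  · have h1 : ¬ l + 1 ≤ k := by omega
    have e1 : prevLevel T k l = 0 := prevLevel_eq_zero hT.eq_zero (by omega)
    have e2 : prevLevel (insertSeq burgeRule T c) k (l + 1) = 0 :=
      prevLevel_eq_zero hz (by omega)
    have e3 : line (insertSeq burgeRule T c) (l + 1) k = 0 := by
      rw [line, e2, hz k (l + 1) (by omega), sub_zero]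
    rw [e3, e1, e2, burgeColumn, if_neg h1, sub_zero, min_eq_right (hc k)]
    refine ⟨rfl, ?_⟩
    rw [burgeColumn, line, e1]
    split_ifs with h2
    · obtain rfl : l = k := by omega
      rw [carryAt_self, prevLevel_eq_zero hz le_rfl, lowerEnds, if_neg (lt_irrefl _)]
      ring
    · rw [hT.eq_zero k l (by omega)]
      ring

/-- Passage through the lines of a pattern, preceded by a column, is passage through the lines of
the pattern into which the column has been inserted by the Burge rule. -/
theorem passageBwd_line_insertSeq {T : ℕ → ℕ → ℝ} (hT : IsPattern T) {c : ℕ → ℝ}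
    (hc : ∀ k, 0 ≤ c k) (M : ℕ) : ∀ h : ℕ → ℝ,
    passageBwd (line T) M (passage (burgeColumn T c M) h) =
      passageBwd (line (insertSeq burgeRule T c)) (M + 1) h := by
  set T' := insertSeq burgeRule T c with hT'
  have key : ∀ (M : ℕ) (h : ℕ → ℝ), passageBwd (line T) M (passage (burgeColumn T c M) h) =
      passage (burgeColumn T c 0) (passageBwd (fun l => line T' (l + 1)) M h) := by
    intro M
    induction M with
    | zero => intro h; rfl
    | succ M ih =>
      intro h
      have hD : ∀ k, prevLevel T (k + 1) M - prevLevel T' (k + 1) (M + 1) =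
          prevLevel T k M - prevLevel T' k (M + 1) + line T M k - line T' (M + 1) k := by
        intro k
        simp only [line, prevLevel]
        ring
      rw [passageBwd, passage_exchange (D := fun k => prevLevel T k M - prevLevel T' k (M + 1))
        (fun k => (burgeColumn_spec hT hc M k).1) (fun k => (burgeColumn_spec hT hc M k).2) hD h,
        ih, passageBwd]
  intro h
  rw [key, burgeColumn_zero, passageBwd_succ]

/-- In the rows below `M`, passage through the first `M` lines of the pattern grown under the Burge
rule is passage through the inserted columns, the last one being entered first. -/
theorem passageBwd_line_growth {x : ℕ → ℕ → ℝ} (hx : ∀ a k, 0 ≤ x a k) (M : ℕ) : ∀ (a : ℕ)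
    {h : ℕ → ℝ}, Monotone h → ∀ k < M,
      passageBwd (line (growth burgeRule x a)) M h k = passageBwd x a h k
  | 0, h, hh, k, hk => by
    have h0 : ∀ l k, line (growth burgeRule x 0) l k = 0 := by
      intro l k; cases k <;> simp [line, growth, prevLevel]
    have all : ∀ M, passageBwd (line (growth burgeRule x 0)) M h = h := by
      intro M
      induction M with
      | zero => rfl
      | succ M ih =>
        have : passage (line (growth burgeRule x 0) M) h = h := funext fun k =>
          passage_of_eq_zero (M := k + 1) (fun k _ => h0 M k) hh k (by omega)
        rw [passageBwd, this, ih]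
    rw [all, passageBwd]
  | a + 1, h, hh, k, hk => by
    have hT := isPattern_growth burgeRule hx a
    have hT' := isPattern_growth burgeRule hx (a + 1)
    rw [passageBwd, ← passageBwd_line_growth hx M a (passage_mono (hx a)) k hk]
    have e1 : ∀ k < M, passage (x a) h k =
        passage (burgeColumn (growth burgeRule x a) (x a) M) h k :=
      passage_congr (fun k hk => by rw [burgeColumn, if_neg (by omega)]) fun _ _ => rfl
    rw [passageBwd_congr _ M e1 k hk, passageBwd_line_insertSeq hT (hx a), passageBwd]
    refine passageBwd_congr _ M (fun k hk => ?_) k hk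
    refine (passage_of_eq_zero (M := M) (fun k hk => ?_) hh k hk).symm
    exact sub_eq_zero.2 ((hT'.eq_zero k M hk).trans (prevLevel_eq_zero hT'.eq_zero hk.le).symm)

/-- The first entries under the Burge rule are passage times through the columns in the order
opposite to that of their insertion. -/
theorem growth_burgeRule {x : ℕ → ℕ → ℝ} (hx : ∀ a k, 0 ≤ x a k) (a k : ℕ) :
    growth burgeRule x a k 0 = passageBwd x a 0 k := by
  rw [← passageBwd_line_growth hx (k + 1) a (h := 0) monotone_const k (by omega)]
  exact (passageBwd_line (isPattern_growth burgeRule hx a) (by omega)).symm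

/-! ### Recursion for last passage times -/

/-- `isGreatest_lppTime` with the length of the paths as a variable. -/
theorem isGreatest_lppTime_of_gridDist (x : ℕ × ℕ → ℝ) {u v : ℕ × ℕ} {m : ℕ}
    (h : gridDist u v = m) :
    IsGreatest {s : ℝ | ∃ π : Fin (m + 1) → ℕ × ℕ, (π 0 = u ∧ π (Fin.last m) = v ∧
      ∀ k : Fin m, gridDist (π k.castSucc) (π k.succ) = 1) ∧ s = ∑ k, x (π k)}
      (lppTime x u v) := by
  subst h
  exact isGreatest_lppTime x u v

theorem gridDist_triangle (u v w : ℕ × ℕ) : gridDist u w ≤ gridDist u v + gridDist v w := by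
  simp only [gridDist]; omega

theorem gridDist_le_of_steps {m : ℕ} {π : Fin (m + 1) → ℕ × ℕ}
    (h : ∀ k : Fin m, gridDist (π k.castSucc) (π k.succ) = 1) (i : Fin (m + 1)) :
    gridDist (π 0) (π i) ≤ i := by
  induction i using Fin.induction with
  | zero => simp [gridDist]
  | succ i ih =>
    have h1 := gridDist_triangle (π 0) (π i.castSucc) (π i.succ)
    have h2 := h i
    simp only [Fin.val_castSucc, Fin.val_succ] at ih ⊢
    omega

/-- Last-step decomposition: the last passage time to `v` is the weight of `v` plus the largest
last passage time to a neighbour of `v` that is one step nearer to `u`. -/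
theorem isGreatest_lppTime_last (x : ℕ × ℕ → ℝ) {u v : ℕ × ℕ} {m : ℕ}
    (h : gridDist u v = m + 1) :
    IsGreatest {s : ℝ | ∃ w, (gridDist u w = m ∧ gridDist w v = 1) ∧ s = lppTime x u w + x v}
      (lppTime x u v) := by
  have hub : ∀ w, gridDist u w = m → gridDist w v = 1 →
      lppTime x u w + x v ≤ lppTime x u v := by
    intro w hw hwv
    obtain ⟨π, ⟨h0, hl, hs⟩, hsum⟩ := (isGreatest_lppTime_of_gridDist x hw).1
    rw [hsum]
    refine (isGreatest_lppTime_of_gridDist x h).2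
      ⟨Fin.snoc (α := fun _ => ℕ × ℕ) π v, ⟨?_, Fin.snoc_last _ _, fun k => ?_⟩, ?_⟩
    · rw [← Fin.castSucc_zero, Fin.snoc_castSucc, h0]
    · refine Fin.lastCases ?_ (fun j => ?_) k
      · rw [Fin.snoc_castSucc, Fin.succ_last, Fin.snoc_last, hl, hwv]
      · rw [Fin.snoc_castSucc, Fin.succ_castSucc, Fin.snoc_castSucc, hs j]
    · refine Eq.trans ?_ (Fin.sum_univ_castSucc _).symm
      simp only [Fin.snoc_castSucc, Fin.snoc_last]
  refine ⟨?_, ?_⟩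
  · obtain ⟨π, ⟨h0, hl, hs⟩, hsum⟩ := (isGreatest_lppTime_of_gridDist x h).1
    have hwv : gridDist (π (Fin.last m).castSucc) v = 1 := by
      rw [← hl, ← Fin.succ_last]; exact hs (Fin.last m)
    have hw : gridDist u (π (Fin.last m).castSucc) = m := by
      have h1 := gridDist_triangle u (π (Fin.last m).castSucc) v
      have h2 := gridDist_le_of_steps hs (Fin.last m).castSucc
      rw [h0] at h2
      simp only [Fin.val_castSucc, Fin.val_last] at h2
      omega
    refine ⟨_, ⟨hw, hwv⟩, le_antisymm ?_ (hub _ hw hwv)⟩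
    rw [hsum, Fin.sum_univ_castSucc, hl]
    refine add_le_add_left ((isGreatest_lppTime_of_gridDist x hw).2
      ⟨fun k => π k.castSucc, ⟨h0, rfl, fun k => ?_⟩, rfl⟩) _
    exact hs k.castSucc
  · rintro s ⟨w, ⟨hw, hwv⟩, rfl⟩
    exact hub w hw hwv

theorem lppTime_self (x : ℕ × ℕ → ℝ) (u : ℕ × ℕ) : lppTime x u u = x u := by
  obtain ⟨π, ⟨h0, -, -⟩, hsum⟩ :=
    (isGreatest_lppTime_of_gridDist x (u := u) (v := u) (m := 0) (by simp [gridDist])).1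
  rw [hsum]
  simp [h0]

theorem lppTime_eq_of_one (x : ℕ × ℕ → ℝ) {u v p : ℕ × ℕ} {m : ℕ} (h : gridDist u v = m + 1)
    (hp : ∀ w, (gridDist u w = m ∧ gridDist w v = 1) ↔ w = p) :
    lppTime x u v = lppTime x u p + x v := by
  refine (isGreatest_lppTime_last x h).unique ⟨⟨p, (hp p).2 rfl, rfl⟩, ?_⟩
  rintro s ⟨w, hw, rfl⟩
  rw [(hp w).1 hw]

theorem lppTime_eq_of_two (x : ℕ × ℕ → ℝ) {u v p q : ℕ × ℕ} {m : ℕ} (h : gridDist u v = m + 1)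
    (hp : ∀ w, (gridDist u w = m ∧ gridDist w v = 1) ↔ w = p ∨ w = q) :
    lppTime x u v = max (lppTime x u p) (lppTime x u q) + x v := by
  refine (isGreatest_lppTime_last x h).unique ⟨?_, ?_⟩
  · rcases max_choice (lppTime x u p) (lppTime x u q) with hm | hm <;> rw [hm]
    · exact ⟨p, (hp p).2 (.inl rfl), rfl⟩
    · exact ⟨q, (hp q).2 (.inr rfl), rfl⟩
  · rintro s ⟨w, hw, rfl⟩
    refine add_le_add_left ?_ _
    rcases (hp w).1 hw with rfl | rfl
    · exact le_max_left _ _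
    · exact le_max_right _ _

/-- Last passage times are passage times through the columns `pos 0, …, pos i`, where `pos` runs
through consecutive abscissae in increasing or in decreasing order. Starting the passage with
`h = 0` is correct because the weights of the first column are nonnegative. -/
theorem lppTime_eq_passageFwd (x : ℕ × ℕ → ℝ) {pos : ℕ → ℕ} {D : ℕ}
    (hpos : (∀ i ≤ D, pos i = pos 0 + i) ∨ (∀ i ≤ D, pos i + i = pos 0))
    (hx : ∀ j, 0 ≤ x (pos 0, j + 1)) : ∀ i ≤ D, ∀ j : ℕ,
    lppTime x (pos 0, 1) (pos i, j + 1) = passageFwd (fun i j => x (pos i, j + 1)) (i + 1) 0 j := by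
  intro i
  induction i with
  | zero =>
    intro hi j
    induction j with
    | zero => simp [lppTime_self, passageFwd, passage]
    | succ j ih =>
      have h : ∀ j, 0 ≤ passage (fun j => x (pos 0, j + 1)) 0 j := by
        intro j
        induction j with
        | zero => simpa [passage] using hx 0
        | succ j ih => exact add_nonneg (ih.trans (le_max_right _ _)) (hx _)
      simp only [passageFwd] at ih ⊢
      rw [lppTime_eq_of_one x (p := (pos 0, j + 1)) (m := j), ih, passage,
        max_eq_right (show (0 : ℕ → ℝ) (j + 1) ≤ _ from h j)]
      · simp only [gridDist]; omega
      · rintro ⟨a, b⟩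
        simp only [gridDist, Prod.mk.injEq]
        omega
  | succ i ihi =>
    intro hi j
    have hp : (pos i = pos 0 + i ∧ pos (i + 1) = pos 0 + (i + 1)) ∨
        (pos i + i = pos 0 ∧ pos (i + 1) + (i + 1) = pos 0) := by
      rcases hpos with h | h
      · exact .inl ⟨h i (by omega), h (i + 1) hi⟩
      · exact .inr ⟨h i (by omega), h (i + 1) hi⟩
    rw [passageFwd]
    induction j with
    | zero =>
      rw [passage, ← ihi (by omega) 0]
      refine lppTime_eq_of_one x (m := i) ?_ ?_
      · simp only [gridDist]; omega
      · rintro ⟨a, b⟩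
        simp only [gridDist, Prod.mk.injEq]
        omega
    | succ j ih =>
      rw [passage, ← ih, ← ihi (by omega) (j + 1)]
      refine lppTime_eq_of_two x (m := i + 1 + j) ?_ ?_
      · simp only [gridDist]; omega
      · rintro ⟨a, b⟩
        simp only [gridDist, Prod.mk.injEq]
        omega

/-- `V_n` in terms of insertion by the Robinson–Schensted–Knuth rule. -/
theorem vecV_eq_growth (n : ℕ) (x : ℕ × ℕ → ℝ) (hx : ∀ i j, 0 ≤ x (i + 1, j + 1))
    (k : Fin (n - 1)) :
    vecV n x k = growth rskRule (fun i j => x (i + 1, j + 1)) (n - 1 - k) k 0 := by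
  have hk := k.2
  have h := lppTime_eq_passageFwd x (pos := fun i => i + 1) (D := n)
    (.inl fun i _ => by omega) (fun j => hx 0 j) (n - 1 - k - 1) (by omega) k
  rw [show n - 1 - (k : ℕ) - 1 + 1 = n - 1 - k by omega] at h
  rw [vecV, show n - ((k : ℕ) + 1) = n - 1 - k by omega]
  exact h.trans (congrFun (growth_rskRule _ _) k).symm

/-- `W_n` in terms of insertion by the Burge rule. -/
theorem vecW_eq_growth (n : ℕ) (x : ℕ × ℕ → ℝ) (hx : ∀ i j, 0 ≤ x (i + 1, j + 1))
    (k : Fin (n - 1)) :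
    vecW n x k = growth burgeRule (fun i j => x (i + 1, j + 1)) (n - 1 - k) k 0 := by
  have hk := k.2
  obtain ⟨s, hs⟩ : ∃ s, n - 1 - (k : ℕ) = s + 1 := ⟨n - 1 - k - 1, by omega⟩
  have h := lppTime_eq_passageFwd x (pos := fun i => s - i + 1) (D := s)
    (.inr fun i _ => by omega) (fun j => hx _ j) s le_rfl k
  rw [vecW, show n - ((k : ℕ) + 1) = s + 1 by omega, hs, growth_burgeRule (fun i j => hx i j),
    passageBwd_eq_passageFwd]
  simpa using h

end LPP

namespace LPP

open scoped ENNReal NNReal BoundedContinuousFunction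

/-! ### Laws of independent arrays -/

namespace Tower

variable {E : ℕ → Type}

/-- A tower from its entries. -/
def ofInit : ∀ (K : ℕ), (∀ k, k < K → E k) → Tower E K
  | 0, _ => ()
  | K + 1, v => (ofInit K fun k hk => v k (by omega), v K (by omega))

theorem ofInit_eq_ofSeq (x : ∀ k, E k) : ∀ K, ofInit K (fun k _ => x k) = ofSeq x K
  | 0 => rfl
  | K + 1 => by rw [ofInit, ofSeq, ofInit_eq_ofSeq x K]

theorem measurable_ofInit [∀ k, MeasurableSpace (E k)] {α : Type*} [MeasurableSpace α] :
    ∀ (K : ℕ) {v : ∀ k, k < K → α → E k}, (∀ k hk, Measurable (v k hk)) →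
      Measurable fun a => ofInit K fun k hk => v k hk a
  | 0, _, _ => measurable_const
  | K + 1, _, hv => (measurable_ofInit K fun k hk => hv k (by omega)).prodMk (hv K (by omega))

theorem measurable_ofSeq [∀ k, MeasurableSpace (E k)] {α : Type*} [MeasurableSpace α]
    {x : ∀ k, α → E k} (hx : ∀ k, Measurable (x k)) (K : ℕ) :
    Measurable fun a => ofSeq (fun k => x k a) K := by
  simp only [← ofInit_eq_ofSeq]
  exact measurable_ofInit K fun k _ => hx k

/-- The joint law of finitely many independent variables is a product. -/
theorem map_ofSeq [∀ k, MeasurableSpace (E k)] {Ω : Type*} [MeasurableSpace Ω] {P : Measure Ω}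
    {Z : ∀ k, Ω → E k} (hZ : ∀ k, Measurable (Z k)) (hind : iIndepFun Z P)
    {μ : ∀ k, Measure (E k)} [∀ k, IsProbabilityMeasure (μ k)] (hlaw : ∀ k, P.map (Z k) = μ k) :
    ∀ K, P.map (fun ω => ofSeq (fun k => Z k ω) K) = measure μ K
  | 0 => by
    have := hind.isProbabilityMeasure
    change P.map (fun _ => ()) = Measure.dirac ()
    rw [Measure.map_const, measure_univ, one_smul]
  | K + 1 => by
    have := hind.isProbabilityMeasure
    have h := hind.indepFun_finset (Finset.range K) {K} (by simp) hZ
    have hg : Measurable fun v : (∀ i : Finset.range K, E i) =>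
        ofInit (E := E) K fun k hk => v ⟨k, Finset.mem_range.2 hk⟩ :=
      measurable_ofInit K (v := fun k hk (v : ∀ i : Finset.range K, E i) =>
        v ⟨k, Finset.mem_range.2 hk⟩) fun k hk => measurable_pi_apply _
    have hg' : Measurable fun v : (∀ i : ({K} : Finset ℕ), E i) =>
        v ⟨K, Finset.mem_singleton_self K⟩ := measurable_pi_apply _
    have h2 := h.comp hg hg'
    have h3 : IndepFun (fun ω => ofSeq (fun k => Z k ω) K) (Z K) P := by
      refine h2.congr (Filter.EventuallyEq.of_eq ?_) (Filter.EventuallyEq.of_eq rfl)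
      exact funext fun ω => ofInit_eq_ofSeq (fun k => Z k ω) K
    have h4 := (indepFun_iff_map_prod_eq_prod_map_map (measurable_ofSeq hZ K).aemeasurable
      (hZ K).aemeasurable).1 h3
    rw [map_ofSeq hZ hind hlaw K, hlaw K] at h4
    exact h4

end Tower

namespace Pattern

theorem measurable_staircase {Ω : Type*} [MeasurableSpace Ω] {y : ℕ → ℕ → Ω → ℝ}
    (hy : ∀ i j, Measurable (y i j)) (N K : ℕ) :
    Measurable fun ω => staircase N (fun i j => y i j ω) K :=
  Tower.measurable_ofSeq (E := fun k => Column (k + 1))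
    (fun k => Tower.measurable_ofSeq (E := fun _ => ℝ) (fun j => hy (N - 1 - k) j) (k + 1)) K

/-- The staircase part of an array of independent exponential weights has the product law. -/
theorem map_staircase {Ω : Type*} [MeasurableSpace Ω] {P : Measure Ω} {r : ℝ} (hr : 0 < r)
    {Y : ℕ × ℕ → Ω → ℝ} (hY : ∀ p, Measurable (Y p)) (hind : iIndepFun Y P)
    (hlaw : ∀ p, P.map (Y p) = expMeasure r) (N : ℕ) :
    P.map (fun ω => staircase N (fun i j => Y (i, j) ω) N) = staircaseLaw r N := by
  have := hind.isProbabilityMeasure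
  have := isProbabilityMeasure_expMeasure hr
  have hcol : ∀ i, iIndepFun (fun j => Y (i, j)) P := fun i =>
    hind.precomp (g := fun j => (i, j)) fun a b h => (Prod.mk.inj h).2
  -- the columns of the array are independent
  have hcols : iIndepFun (fun i ω j => Y (i, j) ω) P := by
    rw [iIndepFun_iff_map_fun_eq_infinitePi_map (by fun_prop)]
    have h1 : ∀ i, P.map (fun ω j => Y (i, j) ω) = Measure.infinitePi fun _ => expMeasure r := by
      intro i
      rw [(iIndepFun_iff_map_fun_eq_infinitePi_map (by fun_prop)).1 (hcol i)]
      simp only [hlaw]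
    simp only [h1]
    have h2 := (iIndepFun_iff_map_fun_eq_infinitePi_map hY).1 hind
    simp only [hlaw] at h2
    rw [← Measure.infinitePi_map_curry (ι := ℕ) (κ := ℕ) (X := ℝ) (fun _ _ => expMeasure r), ← h2,
      Measure.map_map (MeasurableEquiv.measurable _) (measurable_pi_lambda _ hY)]
    rfl
  -- an injective choice of columns that gives the columns of the staircase for `k < N`
  set σ : ℕ → ℕ := fun k => if k < N then N - 1 - k else k with hσ
  have hinj : Function.Injective σ := by
    intro a b h
    simp only [hσ] at h
    split_ifs at h <;> omega
  have hst : ∀ ω, staircase N (fun i j => Y (i, j) ω) N = Tower.ofSeq (fun k =>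
      (Tower.ofSeq (fun j => Y (σ k, j) ω) (k + 1) : Column (k + 1))) N := fun ω =>
    Tower.ofSeq_congr fun k hk => by simp only [hσ, if_pos hk]
  simp only [hst]
  refine Tower.map_ofSeq (E := fun k => Column (k + 1))
    (Z := fun k ω => Tower.ofSeq (fun j => Y (σ k, j) ω) (k + 1))
    (fun k => Tower.measurable_ofSeq (fun j => hY _) _) ?_ (fun k => ?_) N
  · refine (hcols.precomp hinj).comp
      (fun k (c : ℕ → ℝ) => (Tower.ofSeq c (k + 1) : Column (k + 1))) fun k => ?_
    exact Tower.measurable_ofSeq (E := fun _ => ℝ) (fun j => measurable_pi_apply j) _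
  · exact Tower.map_ofSeq (E := fun _ => ℝ) (fun j => hY _) (hcol (σ k)) (fun j => hlaw _) (k + 1)

/-- The first `N` entries of a record in reverse order. -/
def readRecord (N : ℕ) (s : ℕ → ℝ) : Fin N → ℝ := fun k => s (N - 1 - k)

theorem continuous_readRecord (N : ℕ) : Continuous (readRecord N) :=
  continuous_pi fun _ => continuous_apply _

theorem continuous_record_zero (φ : LocalRule) (N : ℕ) : Continuous (record φ (zero N)) :=
  (continuous_record φ (K := N)).comp (Continuous.prodMk_right (zero N))

theorem readRecord_staircase (φ : LocalRule) (N : ℕ) (x : ℕ → ℕ → ℝ) (k : Fin N) :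
    readRecord N (record φ (zero N) (staircase N x N)) k = growth φ x (N - k) k 0 := by
  have hk := k.2
  refine (record_staircase φ N x N 0 (by omega) (N - 1 - k) (by omega)).trans ?_
  rw [show 0 + (N - 1 - (k : ℕ)) + 1 = N - k by omega, show N - 1 - (N - 1 - (k : ℕ)) = k by omega]

/-- The law of the record of the zero pattern does not depend on the local rule. -/
theorem map_record_zero (φ ψ : LocalRule) {r : ℝ} (hr : 0 < r) (N : ℕ) :
    (staircaseLaw r N).map (fun x => readRecord N (record φ (zero N) x)) =
      (staircaseLaw r N).map (fun x => readRecord N (record ψ (zero N) x)) := by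
  have := isProbabilityMeasure_expMeasure hr
  have hm : ∀ χ : LocalRule, Measurable fun x => readRecord N (record χ (zero N) x) := fun χ =>
    ((continuous_readRecord N).comp (continuous_record_zero χ N)).measurable
  have := Measure.isProbabilityMeasure_map (μ := staircaseLaw r N) (hm φ).aemeasurable
  refine ext_of_forall_lintegral_eq_of_IsFiniteMeasure fun f => ?_
  have hf : Measurable fun s => (f s : ℝ≥0∞) :=
    (ENNReal.continuous_coe.comp f.continuous).measurable
  rw [lintegral_map hf (hm φ), lintegral_map hf (hm ψ)]
  exact lintegral_record_zero φ ψ hr N (F := fun s => f (readRecord N s))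
    (f.continuous.comp (continuous_readRecord N))
    fun s => BoundedContinuousFunction.NNReal.upper_bound f _

end Pattern

theorem ae_nonneg_of_hasLaw_exp {Ω : Type*} [MeasurableSpace Ω] {P : Measure Ω} {r : ℝ}
    {Z : Ω → ℝ} (h : HasLaw Z (expMeasure r) P) : ∀ᵐ ω ∂P, 0 ≤ Z ω := by
  refine ae_of_ae_map h.aemeasurable ?_
  rw [h.map_eq]
  have h2 := lintegral_expMeasure r (g := (Set.Iio (0 : ℝ)).indicator 1)
    (measurable_one.indicator measurableSet_Iio)
  rw [lintegral_indicator_one measurableSet_Iio] at h2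
  rw [ae_iff]
  have h3 : {z : ℝ | ¬ 0 ≤ z} = Set.Iio 0 := by ext z; simp
  rw [h3, h2, ← lintegral_zero (μ := volume.restrict (Set.Ici (0 : ℝ)))]
  refine setLIntegral_congr_fun measurableSet_Ici fun c hc => ?_
  rw [Set.indicator_of_notMem (by simpa using hc), mul_zero]

end LPP

theorem mainTheorem2 {Ω : Type*} [MeasurableSpace Ω] (P : Measure Ω) [IsProbabilityMeasure P]
    (r : ℝ) (hr : 0 < r) (X : ℕ × ℕ → Ω → ℝ)
    (hlaw : ∀ p : ℕ × ℕ, 1 ≤ p.1 → 1 ≤ p.2 → HasLaw (X p) (expMeasure r) P)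
    (hindep : iIndepFun (fun (p : {p : ℕ × ℕ // 1 ≤ p.1 ∧ 1 ≤ p.2}) => X p.1) P)
    (n : ℕ) (hn : 2 ≤ n) :
    IdentDistrib (fun ω => LPP.vecV n (fun p => X p ω)) (fun ω => LPP.vecW n (fun p => X p ω))
      P P := by
  have hl : ∀ p : ℕ × ℕ, HasLaw (X (p.1 + 1, p.2 + 1)) (expMeasure r) P := fun p =>
    hlaw _ (by simp) (by simp)
  -- a measurable and nonnegative version of the weights, with indices starting from zero
  set Y : ℕ × ℕ → Ω → ℝ := fun p ω => max ((hl p).aemeasurable.mk _ ω) 0 with hY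
  have hYm : ∀ p, Measurable (Y p) := fun p =>
    (hl p).aemeasurable.measurable_mk.max measurable_const
  have hXY : ∀ p, X (p.1 + 1, p.2 + 1) =ᵐ[P] Y p := fun p => by
    filter_upwards [(hl p).aemeasurable.ae_eq_mk, LPP.ae_nonneg_of_hasLaw_exp (hl p)] with ω h1 h2
    simp only [hY]
    rw [← h1, max_eq_left h2]
  have hYlaw : ∀ p, P.map (Y p) = expMeasure r := fun p => by
    rw [← Measure.map_congr (hXY p), (hl p).map_eq]
  have hYind : iIndepFun Y P := by
    refine iIndepFun.congr hXY (hindep.precomp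
      (g := fun p : ℕ × ℕ => (⟨(p.1 + 1, p.2 + 1), by simp, by simp⟩ :
        {p : ℕ × ℕ // 1 ≤ p.1 ∧ 1 ≤ p.2})) fun p q h => ?_)
    simpa [Prod.ext_iff] using h
  have hall : ∀ᵐ ω ∂P, ∀ i j, X (i + 1, j + 1) ω = Y (i, j) ω :=
    ae_all_iff.2 fun i => ae_all_iff.2 fun j => hXY (i, j)
  set S : Ω → LPP.Staircase (n - 1) := fun ω =>
    LPP.Pattern.staircase (n - 1) (fun i j => Y (i, j) ω) (n - 1) with hS
  have hSm : Measurable S := LPP.Pattern.measurable_staircase (fun i j => hYm (i, j)) _ _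
  have hread : ∀ (φ : LPP.LocalRule), Measurable fun x =>
      LPP.Pattern.readRecord (n - 1) (LPP.Pattern.record φ (LPP.Pattern.zero (n - 1)) x) :=
    fun φ => ((LPP.Pattern.continuous_readRecord _).comp
      (LPP.Pattern.continuous_record_zero φ _)).measurable
  have hV : (fun ω => LPP.vecV n (fun p => X p ω)) =ᵐ[P] fun ω => LPP.Pattern.readRecord (n - 1)
      (LPP.Pattern.record LPP.rskRule (LPP.Pattern.zero (n - 1)) (S ω)) := by
    filter_upwards [hall] with ω hω
    funext k
    rw [LPP.vecV_eq_growth n _ (fun i j => by rw [hω]; exact le_max_right _ _),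
      LPP.Pattern.readRecord_staircase]
    simp only [hω]
  have hW : (fun ω => LPP.vecW n (fun p => X p ω)) =ᵐ[P] fun ω => LPP.Pattern.readRecord (n - 1)
      (LPP.Pattern.record LPP.burgeRule (LPP.Pattern.zero (n - 1)) (S ω)) := by
    filter_upwards [hall] with ω hω
    funext k
    rw [LPP.vecW_eq_growth n _ (fun i j => by rw [hω]; exact le_max_right _ _),
      LPP.Pattern.readRecord_staircase]
    simp only [hω]
  refine ⟨((hread _).comp hSm).aemeasurable.congr hV.symm,
    ((hread _).comp hSm).aemeasurable.congr hW.symm, ?_⟩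
  have hSlaw : P.map S = LPP.staircaseLaw r (n - 1) :=
    LPP.Pattern.map_staircase hr hYm hYind hYlaw (n - 1)
  rw [Measure.map_congr hV, Measure.map_congr hW]
  have hcomp : ∀ φ : LPP.LocalRule, P.map (fun ω => LPP.Pattern.readRecord (n - 1)
      (LPP.Pattern.record φ (LPP.Pattern.zero (n - 1)) (S ω))) =
      (LPP.staircaseLaw r (n - 1)).map fun x => LPP.Pattern.readRecord (n - 1)
        (LPP.Pattern.record φ (LPP.Pattern.zero (n - 1)) x) := fun φ => by
    rw [← hSlaw, Measure.map_map (hread φ) hSm]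
    rfl
  rw [hcomp, hcomp]
  exact LPP.Pattern.map_record_zero _ _ hr (n - 1)
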